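/- Let $A\subset\mathbb R^d$ be a finite point configuration whose convex hull has dimension $d$. A \emph{dissection} of $A$ is a set of $d$-simplices with vertices in $A$ such that no two of them have an interior point in common and their union is $\mathrm{conv}(A)$. A \emph{triangulation} of $A$ is a dissection in which any two simplices intersect in a common (possibly empty) face. The \emph{size} of a dissection is its number of $d$-simplices. A dissection (triangulation) is \emph{maximal} or \emph{minimal} if its size is the largest or the smallest among all dissections (triangulations) of $A$. A dissection of a polytope is a dissection of its vertex set. \emph{Several} means at least three. (1) Consider the eight points $s=(0,0,0)$, $e=(1,0,0)$, $w=(0,1,0)$, $n=(1,1,0)$, $v_1=(-1,0,1)$, $v_2=(1,1,1)$, $u_1=(0,1,-1)$, $u_2=(2,0,-1)$ in $\mathbb R^3$. They are the vertices of a $3$-polytope $P$ whose only integer points are its eight vertices, and: (a) $P$ has a unique maximal dissection; it has $12$ tetrahedra, and all of them are unimodular, i.e. have volume $1/6$. (b) $P$ has several maximal triangulations; they have $11$ tetrahedra. (2) The eight points $u_1=(1,0,0)$, $w=(1,0,1)$, $v_1=(-1,0,0)$, $s=(-1,0,-1)$, $v_2=(0,1,1)$, $n=(1,1,1)$, $u_2=(0,1,-1)$,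 $e=(-1,1,-1)$ are the vertices of a $3$-polytope. It has a unique minimal dissection, of size $6$, and several minimal triangulations, of size $7$; it has several maximal triangulations, of size $9$, and a unique maximal dissection, of size $10$. -/

import Mathlib

open MeasureTheory

/-- `σ` is the vertex set of a full-dimensional simplex of `ℝ^d` with vertices in `A`.
A simplex is represented by its vertex set; as a point set it is `convexHull ℝ σ`. -/
structure IsFullSimplex {d : ℕ} (A : Set (Fin d → ℝ)) (σ : Finset (Fin d → ℝ)) : Prop where
  subset : (σ : Set (Fin d → ℝ)) ⊆ A
  card_eq : σ.card = d + 1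
  affineIndependent : AffineIndependent ℝ ((↑) : σ → (Fin d → ℝ))

/-- A dissection of the point configuration `A`: a set of `d`-simplices with vertices in `A`, no two
of which have an interior point in common, and whose union is `conv A`. -/
structure IsDissection {d : ℕ} (A : Set (Fin d → ℝ)) (D : Finset (Finset (Fin d → ℝ))) :
    Prop where
  simplex : ∀ σ ∈ D, IsFullSimplex A σ
  disjoint_interior : ∀ σ ∈ D, ∀ τ ∈ D, σ ≠ τ →
    Disjoint (interior (convexHull ℝ (σ : Set (Fin d → ℝ))))
      (interior (convexHull ℝ (τ : Set (Fin d → ℝ))))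
  iUnion_eq : (⋃ σ ∈ D, convexHull ℝ (σ : Set (Fin d → ℝ))) = convexHull ℝ A

/-- A triangulation of `A`: a dissection in which any two simplices intersect in a common face,
that is, in the convex hull of a (possibly empty) set of common vertices. -/
structure IsTriangulation {d : ℕ} (A : Set (Fin d → ℝ)) (T : Finset (Finset (Fin d → ℝ))) :
    Prop extends IsDissection A T where
  inter_face : ∀ σ ∈ T, ∀ τ ∈ T, ∃ ρ : Finset (Fin d → ℝ), ρ ⊆ σ ∧ ρ ⊆ τ ∧
    convexHull ℝ (σ : Set (Fin d → ℝ)) ∩ convexHull ℝ (τ : Set (Fin d → ℝ)) =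
      convexHull ℝ (ρ : Set (Fin d → ℝ))

/-- A dissection of `A` with the largest number of simplices among all dissections of `A`. -/
def IsMaxDissection {d : ℕ} (A : Set (Fin d → ℝ)) (D : Finset (Finset (Fin d → ℝ))) : Prop :=
  IsDissection A D ∧ ∀ D', IsDissection A D' → D'.card ≤ D.card

/-- A dissection of `A` with the smallest number of simplices among all dissections of `A`. -/
def IsMinDissection {d : ℕ} (A : Set (Fin d → ℝ)) (D : Finset (Finset (Fin d → ℝ))) : Prop :=
  IsDissection A D ∧ ∀ D', IsDissection A D' → D.card ≤ D'.card

/-- A triangulation of `A` of the largest size among all triangulations of `A`. -/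
def IsMaxTriangulation {d : ℕ} (A : Set (Fin d → ℝ)) (T : Finset (Finset (Fin d → ℝ))) : Prop :=
  IsTriangulation A T ∧ ∀ T', IsTriangulation A T' → T'.card ≤ T.card

/-- A triangulation of `A` of the smallest size among all triangulations of `A`. -/
def IsMinTriangulation {d : ℕ} (A : Set (Fin d → ℝ)) (T : Finset (Finset (Fin d → ℝ))) : Prop :=
  IsTriangulation A T ∧ ∀ T', IsTriangulation A T' → T.card ≤ T'.card

/-- `A` is the set of the `n` vertices of a `d`-dimensional convex polytope in `ℝ^d`, namely of
`conv A`. -/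
structure IsPolytopeVertexSet {d : ℕ} (A : Set (Fin d → ℝ)) (n : ℕ) : Prop where
  encard_eq : A.encard = n
  extremePoints_eq : (convexHull ℝ A).extremePoints ℝ = A
  affineSpan_eq : affineSpan ℝ A = ⊤

/-- The points `s, e, w, n, v₁, v₂, u₁, u₂` of the lattice polytope. -/
def latticePolytopeVertices : Set (Fin 3 → ℝ) :=
  {![0, 0, 0], ![1, 0, 0], ![0, 1, 0], ![1, 1, 0],
    ![-1, 0, 1], ![1, 1, 1], ![0, 1, -1], ![2, 0, -1]}

/-- The points `u₁, w, v₁, s, v₂, n, u₂, e` of the second polytope. -/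
def secondPolytopeVertices : Set (Fin 3 → ℝ) :=
  {![1, 0, 0], ![1, 0, 1], ![-1, 0, 0], ![-1, 0, -1],
    ![0, 1, 1], ![1, 1, 1], ![0, 1, -1], ![-1, 1, -1]}

/-!
The size of a dissection is controlled by linear programming duality. A point `p` of `conv A` that
is on the boundary of no simplex with vertices in `A` lies in exactly one simplex of every
dissection. If finitely many such points carry integer weights, then the weights collected by the
simplices of a dissection add up to the same total for all dissections. If every simplex collects at
least `N`, with equality only for members of a dissection `D₀`, and the total is `N * #D₀`, then
`D₀` is the only dissection of its size and, according to the sign of `N`, there is no larger or no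
smaller one (`IsDissection.card_le_and_eq_of_sampleWeight`). Such weights exist for the maximal
dissection of the lattice polytope and for the minimal and the maximal dissection of the second
polytope; divided by `N`, they are a strictly complementary dual optimum of the linear program whose
variables are the simplices and whose equations are indexed by the sample points.

None of these three dissections is a triangulation: each has two simplices without a common vertex
that contain one diagonal each of a parallelogram of vertices, hence cross each other
(`not_isTriangulation_of_dependence`). So the sizes of triangulations are bounded by the next
integer, and each of these bounds is attained by three triangulations.

That a list of simplices is a dissection or a triangulation is certified in integers:
* interiors are disjoint because of separating planes, and two simplices meet in a common face
  because repeated cuts with separating planes end in a face (`hull_inter_subset_of_meetInFace`);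
* the simplices cover the polytope by the exchange step of Carathéodory's theorem: an affine
  dependence `c` of points `Y` gives `conv Y ⊆ ⋃ i, conv (Y \ {i})`, where `i` ranges over the
  indices with `0 < c i` (`exists_mem_convexHull_erase`, `hull_subset_of_coveredBy`).

The same machinery, applied to the dissection of the unit cube into six tetrahedra, gives the volume
`1 / 6` of unimodular tetrahedra.
-/

/-! ### Convex hulls of finite families -/

section Convexity

variable {ι E : Type*} [AddCommGroup E] [Module ℝ E] {v : ι → E} {s t : Finset ι} {x : E}

theorem mem_convexHull_image_finset :
    x ∈ convexHull ℝ (v '' s) ↔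
      ∃ w : ι → ℝ, (∀ i ∈ s, 0 ≤ w i) ∧ ∑ i ∈ s, w i = 1 ∧ ∑ i ∈ s, w i • v i = x := by
  classical
  constructor
  · have hconv : Convex ℝ {x : E | ∃ w : ι → ℝ, (∀ i ∈ s, 0 ≤ w i) ∧ ∑ i ∈ s, w i = 1 ∧
        ∑ i ∈ s, w i • v i = x} := by
      rintro x ⟨w, hw, hw1, rfl⟩ y ⟨w', hw', hw1', rfl⟩ a b ha hb hab
      refine ⟨fun i => a * w i + b * w' i, fun i hi => ?_, ?_, ?_⟩
      · have := hw i hi; have := hw' i hi; positivity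
      · rw [Finset.sum_add_distrib, ← Finset.mul_sum, ← Finset.mul_sum, hw1, hw1', mul_one,
          mul_one, hab]
      · simp only [add_smul, mul_smul, Finset.sum_add_distrib, Finset.smul_sum]
    refine fun hx => convexHull_min ?_ hconv hx
    rintro _ ⟨i, hi, rfl⟩
    have hi : i ∈ s := hi
    refine ⟨fun j => if j = i then 1 else 0, fun j _ => ?_, ?_, ?_⟩
    · dsimp only; split_ifs <;> norm_num
    · simp [hi]
    · simp [hi]
  · rintro ⟨w, hw, hw1, rfl⟩
    exact (convex_convexHull ℝ _).sum_mem hw hw1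
      fun i hi => subset_convexHull ℝ _ ⟨i, hi, rfl⟩

/-- The exchange step of Carathéodory's theorem: along an affine dependence `c` of the points of
`s`, a convex combination can be moved until a coefficient at which `c` is positive vanishes. -/
theorem exists_mem_convexHull_erase [DecidableEq ι] {c : ι → ℝ} (hc : ∑ i ∈ s, c i = 0)
    (hcv : ∑ i ∈ s, c i • v i = 0) (hpos : ∃ i ∈ s, 0 < c i) (hx : x ∈ convexHull ℝ (v '' s)) :
    ∃ i ∈ s, 0 < c i ∧ x ∈ convexHull ℝ (v '' (s.erase i : Finset ι)) := by
  obtain ⟨w, hw, hw1, rfl⟩ := mem_convexHull_image_finset.1 hx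
  obtain ⟨i₀, hi₀, hci₀⟩ := hpos
  obtain ⟨i, hi, hmin⟩ := (s.filter (0 < c ·)).exists_min_image (fun i => w i / c i)
    ⟨i₀, Finset.mem_filter.2 ⟨hi₀, hci₀⟩⟩
  obtain ⟨his, hci⟩ := Finset.mem_filter.1 hi
  have hθ : 0 ≤ w i / c i := div_nonneg (hw i his) hci.le
  have hi0 : w i - w i / c i * c i = 0 := by field_simp; ring
  refine ⟨i, his, hci, mem_convexHull_image_finset.2
    ⟨fun j => w j - w i / c i * c j, fun j hj => ?_, ?_, ?_⟩⟩
  · have hjs := Finset.mem_of_mem_erase hj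
    rcases le_or_gt (c j) 0 with hcj | hcj
    · have := hw j hjs
      nlinarith
    · have := (le_div_iff₀ hcj).1 (hmin j (Finset.mem_filter.2 ⟨hjs, hcj⟩))
      linarith
  · have := Finset.add_sum_erase s (fun j => w j - w i / c i * c j) his
    rw [hi0, zero_add] at this
    rw [this, Finset.sum_sub_distrib, ← Finset.mul_sum, hw1, hc]; ring
  · have := Finset.add_sum_erase s (fun j => (w j - w i / c i * c j) • v j) his
    rw [hi0, zero_smul, zero_add] at this
    rw [this]
    simp only [sub_smul, mul_smul, Finset.sum_sub_distrib, ← Finset.smul_sum, hcv]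
    simp

/-- A point of a polytope on a supporting hyperplane is a convex combination of the vertices on
that hyperplane. -/
theorem mem_convexHull_filter_of_le {f : E →ₗ[ℝ] ℝ} {c : ℝ} [DecidablePred fun i => f (v i) = c]
    (hs : ∀ i ∈ s, f (v i) ≤ c) (hx : x ∈ convexHull ℝ (v '' s)) (hfx : c ≤ f x) :
    x ∈ convexHull ℝ (v '' (s.filter fun i => f (v i) = c : Finset ι)) := by
  obtain ⟨w, hw, hw1, rfl⟩ := mem_convexHull_image_finset.1 hx
  have hterm : ∀ i ∈ s, 0 ≤ w i * (c - f (v i)) :=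
    fun i hi => mul_nonneg (hw i hi) (sub_nonneg.2 (hs i hi))
  have hsum : ∑ i ∈ s, w i * (c - f (v i)) = c - f (∑ i ∈ s, w i • v i) := by
    simp only [mul_sub, Finset.sum_sub_distrib, ← Finset.sum_mul, hw1, map_sum, map_smul,
      smul_eq_mul, one_mul]
  have hzero := (Finset.sum_eq_zero_iff_of_nonneg hterm).1
    (le_antisymm (by linarith) (Finset.sum_nonneg hterm))
  have hw0 : ∀ i ∈ s, ¬ f (v i) = c → w i = 0 := fun i hi hne =>
    (mul_eq_zero.1 (hzero i hi)).resolve_right fun h => hne (by linarith)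
  refine mem_convexHull_image_finset.2
    ⟨w, fun i hi => hw i (Finset.mem_filter.1 hi).1, ?_, ?_⟩
  · rw [Finset.sum_filter_of_ne, hw1]
    exact fun i hi hne => by_contra fun h => hne (hw0 i hi h)
  · rw [Finset.sum_filter_of_ne]
    exact fun i hi hne => by_contra fun h => hne (by rw [hw0 i hi h, zero_smul])

theorem le_of_mem_convexHull_image {f : E →ₗ[ℝ] ℝ} {c : ℝ} (hs : ∀ i ∈ s, f (v i) ≤ c)
    (hx : x ∈ convexHull ℝ (v '' s)) : f x ≤ c := by
  refine convexHull_min (t := {x | f x ≤ c}) ?_ (convex_halfSpace_le f.isLinear c) hx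
  rintro _ ⟨i, hi, rfl⟩
  exact hs i hi

theorem ge_of_mem_convexHull_image {f : E →ₗ[ℝ] ℝ} {c : ℝ} (hs : ∀ i ∈ s, c ≤ f (v i))
    (hx : x ∈ convexHull ℝ (v '' s)) : c ≤ f x := by
  refine convexHull_min (t := {x | c ≤ f x}) ?_ (convex_halfSpace_ge f.isLinear c) hx
  rintro _ ⟨i, hi, rfl⟩
  exact hs i hi

theorem mem_convexHull_filter_of_ge {f : E →ₗ[ℝ] ℝ} {c : ℝ} [DecidablePred fun i => f (v i) = c]
    (hs : ∀ i ∈ s, c ≤ f (v i)) (hx : x ∈ convexHull ℝ (v '' s)) (hfx : f x ≤ c) :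
    x ∈ convexHull ℝ (v '' (s.filter fun i => f (v i) = c : Finset ι)) := by
  classical
  have := mem_convexHull_filter_of_le (f := -f) (c := -c) (s := s) (v := v) (x := x)
    (by simpa using hs) hx (by simpa using hfx)
  simpa using this

/-- Two polytopes on different sides of a hyperplane have no interior point in common, provided
that the first one is not contained in the hyperplane. -/
theorem disjoint_interior_of_separated [TopologicalSpace E] [IsTopologicalAddGroup E]
    [ContinuousSMul ℝ E] {f : E →ₗ[ℝ] ℝ} {c : ℝ} (hs : ∀ i ∈ s, f (v i) ≤ c)
    (ht : ∀ i ∈ t, c ≤ f (v i)) (hne : ∃ i ∈ s, f (v i) < c) :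
    Disjoint (interior (convexHull ℝ (v '' s))) (interior (convexHull ℝ (v '' t))) := by
  rw [Set.disjoint_left]
  intro x hxs hxt
  have hxc : f x = c := le_antisymm (le_of_mem_convexHull_image hs (interior_subset hxs))
    (ge_of_mem_convexHull_image ht (interior_subset hxt))
  obtain ⟨i, -, hi⟩ := hne
  -- moving from `x` away from the vertex `v i` leaves the half-space containing the first polytope
  have hcont : Filter.Tendsto (fun r : ℝ => x + r • (x - v i)) (nhdsWithin 0 (Set.Ioi 0))
      (nhds x) := by
    have : Continuous fun r : ℝ => x + r • (x - v i) := by fun_prop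
    simpa using (this.tendsto 0).mono_left nhdsWithin_le_nhds
  obtain ⟨r, hr, hr0⟩ := ((hcont.eventually
    (isOpen_interior.mem_nhds hxs)).and self_mem_nhdsWithin).exists
  have h1 := le_of_mem_convexHull_image hs (interior_subset hr)
  have hr0 : 0 < r := hr0
  rw [map_add, map_smul, map_sub, hxc, smul_eq_mul] at h1
  nlinarith

end Convexity

/-! ### Linear programming duality for dissections -/

section Dissections

variable {d : ℕ} {A : Set (Fin d → ℝ)} {D : Finset (Finset (Fin d → ℝ))}

open Classical in
/-- A point of `conv A` on no boundary of a simplex of a dissection lies in exactly one simplex. -/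
theorem IsDissection.card_filter_mem_eq_one (hD : IsDissection A D) {p : Fin d → ℝ}
    (hp : p ∈ convexHull ℝ A)
    (hgen : ∀ σ ∈ D, p ∈ convexHull ℝ (σ : Set (Fin d → ℝ)) →
      p ∈ interior (convexHull ℝ (σ : Set (Fin d → ℝ)))) :
    (D.filter fun σ : Finset (Fin d → ℝ) => p ∈ convexHull ℝ (σ : Set (Fin d → ℝ))).card = 1 := by
  rw [← hD.iUnion_eq] at hp
  simp only [Set.mem_iUnion, exists_prop] at hp
  obtain ⟨σ, hσ, hpσ⟩ := hp
  rw [Finset.card_eq_one]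
  refine ⟨σ, Finset.ext fun τ => ?_⟩
  rw [Finset.mem_filter, Finset.mem_singleton]
  constructor
  · rintro ⟨hτ, hpτ⟩
    by_contra hne
    exact Set.disjoint_left.1 (hD.disjoint_interior τ hτ σ hσ hne) (hgen τ hτ hpτ) (hgen σ hσ hpσ)
  · rintro rfl
    exact ⟨hσ, hpσ⟩

/-- The total weight of the weighted points `(p, y)` of a list that lie in `conv σ`. -/
noncomputable def sampleWeight (L : List ((Fin d → ℝ) × ℤ)) (σ : Finset (Fin d → ℝ)) : ℤ :=
  open Classical in
  (L.map fun q => if q.1 ∈ convexHull ℝ (σ : Set (Fin d → ℝ)) then q.2 else 0).sum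

theorem IsDissection.sum_sampleWeight (hD : IsDissection A D) {L : List ((Fin d → ℝ) × ℤ)}
    (hL : ∀ q ∈ L, q.1 ∈ convexHull ℝ A)
    (hgen : ∀ q ∈ L, ∀ σ, IsFullSimplex A σ → q.1 ∈ convexHull ℝ (σ : Set (Fin d → ℝ)) →
      q.1 ∈ interior (convexHull ℝ (σ : Set (Fin d → ℝ)))) :
    ∑ σ ∈ D, sampleWeight L σ = (L.map Prod.snd).sum := by
  classical
  induction L with
  | nil => simp [sampleWeight]
  | cons q L ih =>
    have ih := ih (fun r hr => hL r (List.mem_cons_of_mem _ hr))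
      (fun r hr => hgen r (List.mem_cons_of_mem _ hr))
    have hq := hD.card_filter_mem_eq_one (hL q List.mem_cons_self)
      (fun σ hσ => hgen q List.mem_cons_self σ (hD.simplex σ hσ))
    simp only [sampleWeight, List.map_cons, List.sum_cons, Finset.sum_add_distrib] at ih ⊢
    rw [ih, ← Finset.sum_filter, Finset.sum_const, nsmul_eq_mul]
    congr 1
    convert one_mul q.2
    exact_mod_cast hq

/-- Linear programming duality for dissections: if every simplex has weight at least `N`, with
equality only for members of `D₀`, and the total weight is `N` times the size of `D₀`, then `D₀` is
the only dissection of its size, and no dissection `D` has `N * #D > N * #D₀`. -/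
theorem IsDissection.card_le_and_eq_of_sampleWeight (hD : IsDissection A D)
    {D₀ : Finset (Finset (Fin d → ℝ))} {L : List ((Fin d → ℝ) × ℤ)} {N : ℤ}
    (hL : ∀ q ∈ L, q.1 ∈ convexHull ℝ A)
    (hgen : ∀ q ∈ L, ∀ σ, IsFullSimplex A σ → q.1 ∈ convexHull ℝ (σ : Set (Fin d → ℝ)) →
      q.1 ∈ interior (convexHull ℝ (σ : Set (Fin d → ℝ))))
    (hweight : ∀ σ, IsFullSimplex A σ →
      N ≤ sampleWeight L σ ∧ (sampleWeight L σ = N → σ ∈ D₀))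
    (hsum : (L.map Prod.snd).sum = N * D₀.card) :
    N * D.card ≤ N * D₀.card ∧ (D.card = D₀.card → D = D₀) := by
  have htot := hD.sum_sampleWeight hL hgen
  have hterm : ∀ σ ∈ D, 0 ≤ sampleWeight L σ - N :=
    fun σ hσ => sub_nonneg.2 (hweight σ (hD.simplex σ hσ)).1
  have hdiff : ∑ σ ∈ D, (sampleWeight L σ - N) = N * D₀.card - N * D.card := by
    rw [Finset.sum_sub_distrib, htot, hsum, Finset.sum_const, nsmul_eq_mul]; ring
  refine ⟨by linarith [Finset.sum_nonneg hterm], fun hcard => ?_⟩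
  have hz := (Finset.sum_eq_zero_iff_of_nonneg hterm).1 (by rw [hdiff, hcard, sub_self])
  exact Finset.eq_of_subset_of_card_le
    (fun σ hσ => (hweight σ (hD.simplex σ hσ)).2 (sub_eq_zero.1 (hz σ hσ))) hcard.ge

end Dissections

/-! ### Barycentric coordinates in a tetrahedron -/

section Orientation

/-- The determinant with columns `(a, 1), (b, 1), (c, 1), (p, w)`, up to a fixed sign. For `w = 1`
it is six times the signed volume of the tetrahedron `a b c p`; for `w ≠ 0` it tells on which side
of the plane `a b c` the point `w⁻¹ • p` lies. -/
def orient {R : Type*} [Add R] [Sub R] [Mul R] (a b c p : Fin 3 → R) (w : R) : R :=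
  ((b 1 - a 1) * (c 2 - a 2) - (b 2 - a 2) * (c 1 - a 1)) * (p 0 - w * a 0) +
  ((b 2 - a 2) * (c 0 - a 0) - (b 0 - a 0) * (c 2 - a 2)) * (p 1 - w * a 1) +
  ((b 0 - a 0) * (c 1 - a 1) - (b 1 - a 1) * (c 0 - a 0)) * (p 2 - w * a 2)

/-- The smallest of the four barycentric coordinates of `w⁻¹ • p` in the tetrahedron `a b c d`, up
to a positive factor if `w > 0` and the tetrahedron is not degenerate. The order of the arguments of
`orient` accounts for the signs in Cramer's rule. -/
def depth {R : Type*} [Add R] [Sub R] [Mul R] [One R] [Min R] (a b c d p : Fin 3 → R) (w : R) : R :=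
  min (min (orient a b c d 1 * orient a b c p w) (orient a b c d 1 * orient b a d p w))
    (min (orient a b c d 1 * orient a c d p w) (orient a b c d 1 * orient c b d p w))

variable {a b c d p : Fin 3 → ℝ}

theorem orient_div {w : ℝ} (hw : w ≠ 0) :
    orient a b c (fun k => p k / w) 1 = orient a b c p w / w := by
  simp only [orient]; field_simp

theorem depth_div {w : ℝ} (hw : 0 < w) :
    depth a b c d (fun k => p k / w) 1 = depth a b c d p w / w := by
  simp only [depth, orient_div hw.ne', ← min_div_div_right hw.le, mul_div_assoc]

/-- Cramer's rule for barycentric coordinates. -/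
theorem orient_smul_eq : orient a b c d 1 • p = orient c b d p 1 • a + orient a c d p 1 • b +
    orient b a d p 1 • c + orient a b c p 1 • d := by
  ext k
  simp only [Pi.add_apply, Pi.smul_apply, smul_eq_mul, orient]
  fin_cases k <;> simp <;> ring

theorem orient_add_eq : orient c b d p 1 + orient a c d p 1 + orient b a d p 1 + orient a b c p 1 =
    orient a b c d 1 := by
  simp only [orient]; ring

theorem depth_pos_iff : 0 < depth a b c d p 1 ↔
    (0 < orient a b c d 1 * orient a b c p 1 ∧ 0 < orient a b c d 1 * orient b a d p 1) ∧
    (0 < orient a b c d 1 * orient a c d p 1 ∧ 0 < orient a b c d 1 * orient c b d p 1) := by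
  simp only [depth, lt_min_iff]

theorem mem_convexHull_of_depth_pos (h : 0 < depth a b c d p 1) :
    p ∈ convexHull ℝ {a, b, c, d} := by
  obtain ⟨⟨h1, h2⟩, h3, h4⟩ := depth_pos_iff.1 h
  have hD : orient a b c d 1 ≠ 0 := fun h0 => by rw [h0, zero_mul] at h1; exact h1.false
  have hnonneg : ∀ x, 0 < orient a b c d 1 * x → 0 ≤ (orient a b c d 1)⁻¹ * x := fun x hx => by
    have : (orient a b c d 1)⁻¹ * x = orient a b c d 1 * x / orient a b c d 1 ^ 2 := by
      field_simp
    rw [this]; positivity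
  have hp := congrArg (fun y => (orient a b c d 1)⁻¹ • y)
    (orient_smul_eq (a := a) (b := b) (c := c) (d := d) (p := p))
  have hsum := congrArg (fun y => (orient a b c d 1)⁻¹ * y)
    (orient_add_eq (a := a) (b := b) (c := c) (d := d) (p := p))
  simp only [smul_add, smul_smul, inv_mul_cancel₀ hD, one_smul, mul_add] at hp hsum
  have := (convex_convexHull ℝ ({a, b, c, d} : Set (Fin 3 → ℝ))).sum_mem (t := Finset.univ)
    (w := ![(orient a b c d 1)⁻¹ * orient c b d p 1, (orient a b c d 1)⁻¹ * orient a c d p 1,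
      (orient a b c d 1)⁻¹ * orient b a d p 1, (orient a b c d 1)⁻¹ * orient a b c p 1])
    (z := ![a, b, c, d])
    (by intro i _; fin_cases i <;> simp only <;> exact hnonneg _ (by assumption))
    (by simpa [Fin.sum_univ_succ, add_assoc] using hsum)
    (by intro i _; apply subset_convexHull; fin_cases i <;> simp)
  rw [hp]
  simpa [Fin.sum_univ_succ, add_assoc] using this

theorem continuous_orient : Continuous fun p : Fin 3 → ℝ => orient a b c p 1 := by
  unfold orient; fun_prop

theorem mem_interior_of_depth_pos (h : 0 < depth a b c d p 1) :
    p ∈ interior (convexHull ℝ {a, b, c, d}) := by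
  refine interior_maximal (fun q hq => mem_convexHull_of_depth_pos hq)
    (isOpen_lt (f := fun _ => 0) (g := fun q => depth a b c d q 1) continuous_const ?_) h
  unfold depth
  have := @continuous_orient
  fun_prop

theorem depth_nonneg_of_mem (h : p ∈ convexHull ℝ {a, b, c, d}) : 0 ≤ depth a b c d p 1 := by
  have hconv : Convex ℝ {q | 0 ≤ depth a b c d q 1} := by
    intro x hx y hy r s hr hs hrs
    have aff : ∀ e f g : Fin 3 → ℝ,
        orient e f g (r • x + s • y) 1 = r * orient e f g x 1 + s * orient e f g y 1 := by
      intro e f g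
      obtain rfl : s = 1 - r := by linarith
      simp only [orient, Pi.add_apply, Pi.smul_apply, smul_eq_mul]
      ring
    simp only [Set.mem_ofPred_eq, depth, le_min_iff, aff] at hx hy ⊢
    obtain ⟨⟨h1, h2⟩, h3, h4⟩ := hx
    obtain ⟨⟨k1, k2⟩, k3, k4⟩ := hy
    refine ⟨⟨?_, ?_⟩, ?_, ?_⟩
    · nlinarith [mul_nonneg hr h1, mul_nonneg hs k1]
    · nlinarith [mul_nonneg hr h2, mul_nonneg hs k2]
    · nlinarith [mul_nonneg hr h3, mul_nonneg hs k3]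
    · nlinarith [mul_nonneg hr h4, mul_nonneg hs k4]
  refine convexHull_min ?_ hconv h
  have hz : ∀ x : ℝ, 0 ≤ min (min x 0) (min 0 0) ↔ 0 ≤ x := fun x => by simp
  have e1 : ∀ x y z : Fin 3 → ℝ, orient x y z x 1 = 0 := fun x y z => by simp only [orient]; ring
  have e2 : ∀ x y z : Fin 3 → ℝ, orient x y z y 1 = 0 := fun x y z => by simp only [orient]; ring
  have e3 : ∀ x y z : Fin 3 → ℝ, orient x y z z 1 = 0 := fun x y z => by simp only [orient]; ring
  have f1 : orient b a d c 1 = orient a b c d 1 := by simp only [orient]; ring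
  have f2 : orient a c d b 1 = orient a b c d 1 := by simp only [orient]; ring
  have f3 : orient c b d a 1 = orient a b c d 1 := by simp only [orient]; ring
  have hsq : 0 ≤ orient a b c d 1 * orient a b c d 1 := mul_self_nonneg _
  rintro q (rfl | rfl | rfl | rfl) <;>
    simp [depth, e1, e2, e3, f1, f2, f3, hsq]

theorem orient_ne_zero_of_affineIndependent (h : AffineIndependent ℝ ![a, b, c, d]) :
    orient a b c d 1 ≠ 0 := by
  rw [affineIndependent_iff_linearIndependent_vsub ℝ _ (0 : Fin 4)] at h
  have h' : LinearIndependent ℝ ![b - a, c - a, d - a] := by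
    have := h.comp (fun i : Fin 3 => (⟨i.succ, Fin.succ_ne_zero i⟩ : {x : Fin 4 // x ≠ 0}))
      (fun i j hij => by simpa using hij)
    have e : (fun i : {x : Fin 4 // x ≠ 0} => ![a, b, c, d] i -ᵥ ![a, b, c, d] 0) ∘
        (fun i : Fin 3 => ⟨i.succ, Fin.succ_ne_zero i⟩) = ![b - a, c - a, d - a] := by
      ext i k
      fin_cases i <;> rfl
    rwa [e] at this
  have := (Matrix.linearIndependent_rows_iff_isUnit (A := Matrix.of ![b - a, c - a, d - a])).1 h'
  rw [Matrix.isUnit_iff_isUnit_det, isUnit_iff_ne_zero, Matrix.det_fin_three] at this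
  intro h0
  apply this
  simp [orient] at h0 ⊢
  linarith

theorem affineIndependent_of_orient_ne_zero (h : orient a b c d 1 ≠ 0) :
    AffineIndependent ℝ ![a, b, c, d] := by
  rw [affineIndependent_iff_linearIndependent_vsub ℝ _ (0 : Fin 4)]
  have h' : LinearIndependent ℝ ![b - a, c - a, d - a] := by
    refine (Matrix.linearIndependent_rows_iff_isUnit (A := Matrix.of ![b - a, c - a, d - a])).2 ?_
    rw [Matrix.isUnit_iff_isUnit_det, isUnit_iff_ne_zero, Matrix.det_fin_three]
    intro h0
    apply h
    simp [orient] at h0 ⊢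
    linarith
  have e : Function.Bijective
      (fun i : Fin 3 => (⟨i.succ, Fin.succ_ne_zero i⟩ : {x : Fin 4 // x ≠ 0})) := by decide
  rw [← linearIndependent_equiv (Equiv.ofBijective _ e)]
  have e' : (fun i : {x : Fin 4 // x ≠ 0} => ![a, b, c, d] i -ᵥ ![a, b, c, d] 0) ∘
      (Equiv.ofBijective _ e) = ![b - a, c - a, d - a] := by
    ext i k
    fin_cases i <;> rfl
  rwa [e']

variable {A : Set (Fin 3 → ℝ)}

theorem isFullSimplex_of_orient_ne_zero (ha : a ∈ A) (hb : b ∈ A) (hc : c ∈ A) (hd : d ∈ A)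
    (h : orient a b c d 1 ≠ 0) : IsFullSimplex A {a, b, c, d} := by
  have hi := affineIndependent_of_orient_ne_zero h
  have hcoe : ((({a, b, c, d} : Finset (Fin 3 → ℝ))) : Set (Fin 3 → ℝ)) =
      Set.range ![a, b, c, d] := by
    ext x; simp [eq_comm]; tauto
  refine ⟨?_, ?_, ?_⟩
  · intro x
    simp only [Finset.coe_insert, Finset.coe_singleton]
    rintro (rfl | rfl | rfl | rfl) <;> assumption
  · have := hi.injective
    rw [← Set.ncard_coe_finset, hcoe, ← Set.image_univ, Set.ncard_image_of_injective _ this,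
      Set.ncard_univ, Nat.card_eq_fintype_card, Fintype.card_fin]
  · have := hi.range
    rw [← hcoe] at this
    exact this

theorem IsFullSimplex.orient_ne_zero {σ : Finset (Fin 3 → ℝ)} (h : IsFullSimplex A σ)
    (hσ : σ = {a, b, c, d}) : orient a b c d 1 ≠ 0 := by
  apply orient_ne_zero_of_affineIndependent
  have hcard := h.card_eq
  have hmem : ∀ i : Fin 4, ![a, b, c, d] i ∈ σ := by
    rw [hσ]; intro i; fin_cases i <;> simp
  have hinj : Function.Injective ![a, b, c, d] := by
    rw [← Set.injOn_univ, ← Finset.coe_univ, ← Finset.card_image_iff]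
    have : Finset.univ.image ![a, b, c, d] = σ := by
      rw [hσ]; ext x; simp [Fin.exists_fin_succ, eq_comm]
    rw [this, hcard, Finset.card_univ, Fintype.card_fin]
  exact h.affineIndependent.comp_embedding
    ⟨fun i => (⟨_, hmem i⟩ : σ), fun i j hij => hinj (congrArg Subtype.val hij)⟩

end Orientation

/-! ### Certificates for dissections of integer configurations -/

section IntegerConfigurations

/-- The value of the affine form with coefficients `f` at `x`. -/
def affineForm (f : Fin 4 → ℤ) (x : Fin 3 → ℤ) : ℤ :=
  f 0 * x 0 + f 1 * x 1 + f 2 * x 2 + f 3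

variable {ι : Type*}

/-- The points of `ℝ³` with given integer coordinates. -/
def realPoint (P : ι → Fin 3 → ℤ) (i : ι) : Fin 3 → ℝ := fun k => (P i k : ℝ)

/-- The set of simplices of `ℝ³` given by a list of index sets. -/
noncomputable def realize (P : ι → Fin 3 → ℤ) (S : List (Finset ι)) :
    Finset (Finset (Fin 3 → ℝ)) :=
  (S.map fun s => s.image (realPoint P)).toFinset

variable {P : ι → Fin 3 → ℤ} {S : List (Finset ι)} {F : List (Fin 4 → ℤ)} {s t : Finset ι}

theorem realPoint_injective (h : Function.Injective P) : Function.Injective (realPoint P) := by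
  intro i j hij
  apply h
  ext k
  have := congrFun hij k
  simp only [realPoint] at this
  exact_mod_cast this

theorem orient_realPoint (a b c d : ι) : orient (realPoint P a) (realPoint P b) (realPoint P c)
    (realPoint P d) 1 = (orient (P a) (P b) (P c) (P d) 1 : ℤ) := by
  simp only [orient, realPoint]; push_cast; ring

theorem depth_realPoint (a b c d : ι) (q : Fin 3 → ℤ) (w : ℤ) :
    depth (realPoint P a) (realPoint P b) (realPoint P c) (realPoint P d) (fun k => (q k : ℝ)) w =
      (depth (P a) (P b) (P c) (P d) q w : ℤ) := by
  have h : ∀ a b c : ι, orient (realPoint P a) (realPoint P b) (realPoint P c)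
      (fun k => (q k : ℝ)) w = (orient (P a) (P b) (P c) q w : ℤ) := fun a b c => by
    simp only [orient, realPoint]; push_cast; ring
  simp only [depth, h, orient_realPoint, Int.cast_min, Int.cast_mul]

/-- The linear part of an affine form. -/
noncomputable def linearForm (f : Fin 4 → ℤ) : (Fin 3 → ℝ) →ₗ[ℝ] ℝ :=
  (f 0 : ℝ) • LinearMap.proj 0 + (f 1 : ℝ) • LinearMap.proj 1 + (f 2 : ℝ) • LinearMap.proj 2

theorem linearForm_realPoint (f : Fin 4 → ℤ) (i : ι) :
    linearForm f (realPoint P i) = (affineForm f (P i) : ℤ) - f 3 := by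
  simp [linearForm, affineForm, realPoint]

theorem linearForm_le_iff {f : Fin 4 → ℤ} {i : ι} :
    linearForm f (realPoint P i) ≤ -f 3 ↔ affineForm f (P i) ≤ 0 := by
  rw [linearForm_realPoint, ← @Int.cast_nonpos ℝ]
  constructor <;> intro h <;> linarith

theorem le_linearForm_iff {f : Fin 4 → ℤ} {i : ι} :
    -f 3 ≤ linearForm f (realPoint P i) ↔ 0 ≤ affineForm f (P i) := by
  rw [linearForm_realPoint, ← @Int.cast_nonneg_iff ℝ]
  constructor <;> intro h <;> linarith

theorem linearForm_eq_iff {f : Fin 4 → ℤ} {i : ι} :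
    linearForm f (realPoint P i) = -f 3 ↔ affineForm f (P i) = 0 := by
  rw [le_antisymm_iff, linearForm_le_iff, le_linearForm_iff, le_antisymm_iff]

theorem linearForm_lt_iff {f : Fin 4 → ℤ} {i : ι} :
    linearForm f (realPoint P i) < -f 3 ↔ affineForm f (P i) < 0 := by
  rw [← not_le, le_linearForm_iff, not_le]

/-- The convex hull of the points with indices in `s`. -/
abbrev hull (P : ι → Fin 3 → ℤ) (s : Finset ι) : Set (Fin 3 → ℝ) :=
  convexHull ℝ (realPoint P '' s)

theorem hull_mono (h : s ⊆ t) : hull P s ⊆ hull P t :=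
  convexHull_mono (Set.image_mono (Finset.coe_subset.2 h))

theorem mem_realize {σ : Finset (Fin 3 → ℝ)} :
    σ ∈ realize P S ↔ ∃ s ∈ S, s.image (realPoint P) = σ := by
  simp [realize]

/-- The four points with indices in `s` are the vertices of a tetrahedron. -/
def IsTetrahedron (P : ι → Fin 3 → ℤ) (s : Finset ι) : Prop :=
  s.card = 4 ∧ ∃ a ∈ s, ∃ b ∈ s, ∃ c ∈ s, ∃ d ∈ s, orient (P a) (P b) (P c) (P d) 1 ≠ 0

/-- The affine form `f` is nonpositive on the points of `s` and nonnegative on those of `t`. -/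
def Separates (P : ι → Fin 3 → ℤ) (f : Fin 4 → ℤ) (s t : Finset ι) : Prop :=
  (∀ i ∈ s, affineForm f (P i) ≤ 0) ∧ ∀ i ∈ t, 0 ≤ affineForm f (P i)

instance (P : ι → Fin 3 → ℤ) (s : Finset ι) : Decidable (IsTetrahedron P s) := by
  unfold IsTetrahedron; infer_instance

instance (P : ι → Fin 3 → ℤ) (f : Fin 4 → ℤ) (s t : Finset ι) : Decidable (Separates P f s t) := by
  unfold Separates; infer_instance

/-- Some plane of the list `F` weakly separates `s` from `t`, and does not contain `s`. -/
def AreSeparated (P : ι → Fin 3 → ℤ) (F : List (Fin 4 → ℤ)) (s t : Finset ι) : Prop :=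
  ∃ f ∈ F, (Separates P f s t ∨ Separates P f t s) ∧ ∃ i ∈ s, affineForm f (P i) ≠ 0

instance (P : ι → Fin 3 → ℤ) (F : List (Fin 4 → ℤ)) (s t : Finset ι) :
    Decidable (AreSeparated P F s t) := by
  unfold AreSeparated; infer_instance

theorem AreSeparated.disjoint_interior (h : AreSeparated P F s t) :
    Disjoint (interior (hull P s)) (interior (hull P t)) := by
  obtain ⟨f, -, ⟨hs, ht⟩ | ⟨ht, hs⟩, i, hi, hne⟩ := h
  · exact disjoint_interior_of_separated (f := linearForm f) (c := -f 3)
      (fun i hi => linearForm_le_iff.2 (hs i hi)) (fun i hi => le_linearForm_iff.2 (ht i hi))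
      ⟨i, hi, linearForm_lt_iff.2 (lt_of_le_of_ne (hs i hi) hne)⟩
  · refine disjoint_interior_of_separated (f := -linearForm f) (c := f 3)
      (fun i hi => ?_) (fun i hi => ?_) ⟨i, hi, ?_⟩
    · have := le_linearForm_iff.2 (hs i hi)
      rw [LinearMap.neg_apply]; linarith
    · have := linearForm_le_iff.2 (ht i hi)
      rw [LinearMap.neg_apply]; linarith
    · have h1 := le_linearForm_iff.2 (hs i hi)
      have h2 := mt linearForm_eq_iff.1 hne
      rw [LinearMap.neg_apply]
      have := lt_of_le_of_ne h1 (Ne.symm h2)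
      linarith

theorem Separates.hull_inter_subset {f : Fin 4 → ℤ} (h : Separates P f s t) :
    hull P s ∩ hull P t ⊆ hull P (s.filter fun i => affineForm f (P i) = 0) ∩
      hull P (t.filter fun i => affineForm f (P i) = 0) := by
  classical
  rintro x ⟨hxs, hxt⟩
  have hs : ∀ i ∈ s, linearForm f (realPoint P i) ≤ -f 3 :=
    fun i hi => linearForm_le_iff.2 (h.1 i hi)
  have ht : ∀ i ∈ t, -f 3 ≤ linearForm f (realPoint P i) :=
    fun i hi => le_linearForm_iff.2 (h.2 i hi)
  have h1 := mem_convexHull_filter_of_le hs hxs (ge_of_mem_convexHull_image ht hxt)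
  have h2 := mem_convexHull_filter_of_ge ht hxt (le_of_mem_convexHull_image hs hxs)
  simp only [linearForm_eq_iff] at h1 h2
  exact ⟨h1, h2⟩

theorem card_realize (hP : Function.Injective P) (hS : S.Nodup) :
    (realize P S).card = S.length := by
  rw [realize, List.toFinset_card_of_nodup, List.length_map]
  exact hS.map (Finset.image_injective (realPoint_injective hP))

/-- Two simplices without a common vertex that contain the two parts of a Radon partition cross
each other, which is impossible in a triangulation. -/
theorem not_isTriangulation_of_dependence [Fintype ι] {T : Finset (Finset (Fin 3 → ℝ))}
    (hP : Function.Injective P) (hs : s.image (realPoint P) ∈ T)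
    (ht : t.image (realPoint P) ∈ T) (hst : Disjoint s t) (c : ι → ℤ)
    (hpos : ∃ i, 0 < c i) (hsum : ∑ i, c i = 0) (hdep : ∀ k, ∑ i, c i * P i k = 0)
    (hcs : ∀ i, 0 < c i → i ∈ s) (hct : ∀ i, c i < 0 → i ∈ t) :
    ¬ IsTriangulation (Set.range (realPoint P)) T := by
  intro hT
  obtain ⟨ρ, hρs, hρt, hρ⟩ := hT.inter_face _ hs _ ht
  obtain ⟨j, hj⟩ := hpos
  have hsumR : ∑ i, (c i : ℝ) = 0 := by exact_mod_cast hsum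
  have hdepR : ∑ i, (c i : ℝ) • realPoint P i = 0 := by
    ext k
    simp only [Finset.sum_apply, Pi.smul_apply, smul_eq_mul, realPoint, Pi.zero_apply]
    exact_mod_cast hdep k
  -- the Radon point of the dependence
  set C : ℝ := ∑ i, max (c i : ℝ) 0 with hC
  have hCpos : 0 < C := Finset.sum_pos' (fun i _ => le_max_right _ _)
    ⟨j, Finset.mem_univ j, lt_max_of_lt_left (by exact_mod_cast hj)⟩
  have hsub : ∀ i, max (-(c i : ℝ)) 0 = max (c i : ℝ) 0 - c i := fun i => by
    rcases le_total (c i : ℝ) 0 with h | h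
    · rw [max_eq_left (neg_nonneg.2 h), max_eq_right h]; ring
    · rw [max_eq_right (neg_nonpos.2 h), max_eq_left h]; ring
  have hs0 : ∀ i, i ∉ s → max (c i : ℝ) 0 = 0 := fun i hi =>
    max_eq_right (by exact_mod_cast not_lt.1 (mt (hcs i) hi))
  have ht0 : ∀ i, i ∉ t → max (-(c i : ℝ)) 0 = 0 := fun i hi =>
    max_eq_right (neg_nonpos.2 (by exact_mod_cast not_lt.1 (mt (hct i) hi)))
  set p : Fin 3 → ℝ := ∑ i, (max (c i : ℝ) 0 / C) • realPoint P i with hp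
  have hps : p ∈ hull P s := by
    refine mem_convexHull_image_finset.2 ⟨fun i => max (c i : ℝ) 0 / C,
      fun i _ => div_nonneg (le_max_right _ _) hCpos.le, ?_, ?_⟩
    · rw [Finset.sum_subset (Finset.subset_univ s) (fun i _ hi => by rw [hs0 i hi, zero_div]),
        ← Finset.sum_div, ← hC, div_self hCpos.ne']
    · rw [Finset.sum_subset (Finset.subset_univ s)
        (fun i _ hi => by simp only [hs0 i hi, zero_div, zero_smul])]
  have hpt : p ∈ hull P t := by
    refine mem_convexHull_image_finset.2 ⟨fun i => max (-(c i : ℝ)) 0 / C,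
      fun i _ => div_nonneg (le_max_right _ _) hCpos.le, ?_, ?_⟩
    · rw [Finset.sum_subset (Finset.subset_univ t) (fun i _ hi => by rw [ht0 i hi, zero_div]),
        ← Finset.sum_div]
      simp only [hsub, Finset.sum_sub_distrib, hsumR, sub_zero, ← hC, div_self hCpos.ne']
    · rw [Finset.sum_subset (Finset.subset_univ t)
        (fun i _ hi => by simp only [ht0 i hi, zero_div, zero_smul])]
      simp only [hsub, sub_div, sub_smul, Finset.sum_sub_distrib, ← hp, sub_eq_self]
      simp only [div_eq_inv_mul, mul_smul, ← Finset.smul_sum, hdepR, smul_zero]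
  have hρ0 : ρ = ∅ := Finset.subset_empty.1 ((Finset.disjoint_iff_inter_eq_empty.1
    ((Finset.disjoint_image (realPoint_injective hP)).2 hst)) ▸ Finset.subset_inter hρs hρt)
  have hmem : p ∈ convexHull ℝ (ρ : Set (Fin 3 → ℝ)) := by
    rw [← hρ, Finset.coe_image, Finset.coe_image]
    exact ⟨hps, hpt⟩
  simp [hρ0] at hmem

variable [DecidableEq ι]

/-- At most `n` successive cuts of `s` and `t` with separating planes from the list `F` end with
one set contained in the other one. -/
def meetInFace (P : ι → Fin 3 → ℤ) (F : List (Fin 4 → ℤ)) : ℕ → Finset ι → Finset ι → Bool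
  | 0, s, t => decide (s ⊆ t) || decide (t ⊆ s)
  | n + 1, s, t => decide (s ⊆ t) || decide (t ⊆ s) || F.any fun f =>
      (decide (Separates P f s t) || decide (Separates P f t s)) &&
      (decide (∃ i ∈ s ∪ t, affineForm f (P i) ≠ 0) &&
      meetInFace P F n (s.filter fun i => affineForm f (P i) = 0)
        (t.filter fun i => affineForm f (P i) = 0))

/-- `coveredBy P S L X` certifies that the simplices of the list `S` cover the convex hull of the
points of `X`. An entry `(Y, c)` of `L` is an affine dependence `c` of the points of `Y`; it reduces
the covering of `conv Y` to the coverings of the sets `conv (Y \ {i})` with `0 < c i`. -/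
def coveredBy [Fintype ι] (P : ι → Fin 3 → ℤ) (S : List (Finset ι)) :
    List (Finset ι × (ι → ℤ)) → Finset ι → Bool
  | [], X => S.any fun s => decide (X ⊆ s)
  | (Y, c) :: L, X => coveredBy P S L X || (decide (X ⊆ Y) &&
      (decide ((∀ i, c i ≠ 0 → i ∈ Y) ∧ (∃ i, 0 < c i) ∧ ∑ i, c i = 0 ∧
        ∀ k, ∑ i, c i * P i k = 0) &&
      decide (∀ i, 0 < c i → coveredBy P S L (Y.erase i) = true)))

theorem IsTetrahedron.exists_eq (h : IsTetrahedron P s) : ∃ a b c d, s = {a, b, c, d} ∧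
    orient (P a) (P b) (P c) (P d) 1 ≠ 0 := by
  obtain ⟨hcard, a, ha, b, hb, c, hc, d, hd, hD⟩ := h
  refine ⟨a, b, c, d, ?_, hD⟩
  symm
  have hab : a ≠ b := by rintro rfl; apply hD; simp only [orient]; ring
  have hac : a ≠ c := by rintro rfl; apply hD; simp only [orient]; ring
  have had : a ≠ d := by rintro rfl; apply hD; simp only [orient]; ring
  have hbc : b ≠ c := by rintro rfl; apply hD; simp only [orient]; ring
  have hbd : b ≠ d := by rintro rfl; apply hD; simp only [orient]; ring
  have hcd : c ≠ d := by rintro rfl; apply hD; simp only [orient]; ring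
  apply Finset.eq_of_subset_of_card_le
  · intro x
    simp only [Finset.mem_insert, Finset.mem_singleton]
    rintro (rfl | rfl | rfl | rfl) <;> assumption
  · rw [hcard, Finset.card_insert_of_notMem, Finset.card_insert_of_notMem,
      Finset.card_insert_of_notMem, Finset.card_singleton] <;> simp [*]

theorem IsTetrahedron.isFullSimplex (h : IsTetrahedron P s) :
    IsFullSimplex (Set.range (realPoint P)) (s.image (realPoint P)) := by
  obtain ⟨a, b, c, d, rfl, hD⟩ := h.exists_eq
  simp only [Finset.image_insert, Finset.image_singleton]
  refine isFullSimplex_of_orient_ne_zero ⟨a, rfl⟩ ⟨b, rfl⟩ ⟨c, rfl⟩ ⟨d, rfl⟩ ?_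
  rw [orient_realPoint]
  exact_mod_cast hD

theorem realize_inj {S' : List (Finset ι)} (hP : Function.Injective P)
    (h : realize P S = realize P S') : S.toFinset = S'.toFinset := by
  ext s
  have := Finset.ext_iff.1 h (s.image (realPoint P))
  simp only [mem_realize, (Finset.image_injective (realPoint_injective hP)).eq_iff,
    exists_eq_right] at this
  simpa using this

theorem hull_inter_subset_of_meetInFace {n : ℕ} (h : meetInFace P F n s t = true) :
    hull P s ∩ hull P t ⊆ hull P (s ∩ t) := by
  have triv : ∀ {s t : Finset ι}, s ⊆ t ∨ t ⊆ s → hull P s ∩ hull P t ⊆ hull P (s ∩ t) := by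
    rintro s t (h | h)
    · rw [Finset.inter_eq_left.2 h]; exact Set.inter_subset_left
    · rw [Finset.inter_eq_right.2 h]; exact Set.inter_subset_right
  induction n generalizing s t with
  | zero =>
    simp only [meetInFace, Bool.or_eq_true, decide_eq_true_eq] at h
    exact triv h
  | succ n ih =>
    simp only [meetInFace, Bool.or_eq_true, Bool.and_eq_true, decide_eq_true_eq,
      List.any_eq_true] at h
    obtain h | ⟨f, -, hsep, -, hrec⟩ := h
    · exact triv h
    · have hcut : hull P s ∩ hull P t ⊆ hull P (s.filter fun i => affineForm f (P i) = 0) ∩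
          hull P (t.filter fun i => affineForm f (P i) = 0) := by
        rcases hsep with hsep | hsep
        · exact hsep.hull_inter_subset
        · rw [Set.inter_comm, Set.inter_comm (hull P (s.filter _))]
          exact hsep.hull_inter_subset
      exact (hcut.trans (ih hrec)).trans
        (hull_mono (Finset.inter_subset_inter (Finset.filter_subset _ _)
          (Finset.filter_subset _ _)))

theorem hull_subset_of_coveredBy [Fintype ι] {L : List (Finset ι × (ι → ℤ))} {X : Finset ι}
    (h : coveredBy P S L X = true) : hull P X ⊆ ⋃ s ∈ S, hull P s := by
  induction L generalizing X with
  | nil =>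
    simp only [coveredBy, List.any_eq_true, decide_eq_true_eq] at h
    obtain ⟨s, hs, hXs⟩ := h
    exact (hull_mono hXs).trans (Set.subset_biUnion_of_mem (u := fun s => hull P s) hs)
  | cons q L ih =>
    obtain ⟨Y, c⟩ := q
    simp only [coveredBy, Bool.or_eq_true, Bool.and_eq_true, decide_eq_true_eq] at h
    obtain h | ⟨hXY, ⟨hsupp, ⟨i, hi⟩, hsum, hdep⟩, hrec⟩ := h
    · exact ih h
    · refine (hull_mono hXY).trans fun x hx => ?_
      have hY : ∀ i, i ∉ Y → c i = 0 := fun i hi => by_contra fun h => hi (hsupp i h)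
      obtain ⟨j, -, hj, hxj⟩ := exists_mem_convexHull_erase (c := fun i => (c i : ℝ)) (s := Y)
        (v := realPoint P) (by
          rw [Finset.sum_subset (Finset.subset_univ Y)
            (fun i _ hi => by rw [hY i hi, Int.cast_zero])]
          exact_mod_cast hsum)
        (by
          rw [Finset.sum_subset (Finset.subset_univ Y)
            (fun i _ hi => by rw [hY i hi, Int.cast_zero, zero_smul])]
          ext k
          simp only [Finset.sum_apply, Pi.smul_apply, smul_eq_mul, realPoint, Pi.zero_apply]
          exact_mod_cast hdep k)
        ⟨i, hsupp i hi.ne', by exact_mod_cast hi⟩ hx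
      exact ih (hrec j (by exact_mod_cast hj)) hxj

theorem isDissection_realize [Fintype ι] {L : List (Finset ι × (ι → ℤ))}
    (hS : ∀ s ∈ S, IsTetrahedron P s) (hsep : S.Pairwise (AreSeparated P F))
    (hcov : coveredBy P S L Finset.univ = true) :
    IsDissection (Set.range (realPoint P)) (realize P S) := by
  have hsymm : ∀ s ∈ S, ∀ t ∈ S, s ≠ t →
      Disjoint (interior (hull P s)) (interior (hull P t)) := by
    have hdisj := hsep.imp (S := fun s t => Disjoint (interior (hull P s)) (interior (hull P t)))
      (fun h => h.disjoint_interior)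
    have : Std.Symm fun s t => Disjoint (interior (hull P s)) (interior (hull P t)) :=
      ⟨fun _ _ h => h.symm⟩
    exact fun s hs t ht hst => hdisj.forall hs ht hst
  refine ⟨?_, ?_, ?_⟩
  · intro σ hσ
    obtain ⟨s, hs, rfl⟩ := mem_realize.1 hσ
    exact (hS s hs).isFullSimplex
  · intro σ hσ τ hτ hne
    obtain ⟨s, hs, rfl⟩ := mem_realize.1 hσ
    obtain ⟨t, ht, rfl⟩ := mem_realize.1 hτ
    simpa [hull] using hsymm s hs t ht (fun h => hne (by rw [h]))
  · apply Set.Subset.antisymm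
    · refine Set.iUnion₂_subset fun σ hσ => convexHull_mono ?_
      obtain ⟨s, hs, rfl⟩ := mem_realize.1 hσ
      simp only [Finset.coe_image]
      exact Set.image_subset_range _ _
    · have := hull_subset_of_coveredBy hcov
      rw [hull, Finset.coe_univ, Set.image_univ] at this
      refine this.trans (Set.iUnion₂_subset fun s hs => ?_)
      refine Set.subset_biUnion_of_mem
        (u := fun σ : Finset (Fin 3 → ℝ) => convexHull ℝ (σ : Set (Fin 3 → ℝ)))
        (mem_realize.2 ⟨s, hs, rfl⟩) |>.trans' ?_
      simp

theorem isTriangulation_realize (hD : IsDissection (Set.range (realPoint P)) (realize P S)) {n : ℕ}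
    (hface : S.Pairwise fun s t => meetInFace P F n s t = true) :
    IsTriangulation (Set.range (realPoint P)) (realize P S) := by
  refine ⟨hD, fun σ hσ τ hτ => ?_⟩
  obtain ⟨s, hs, rfl⟩ := mem_realize.1 hσ
  obtain ⟨t, ht, rfl⟩ := mem_realize.1 hτ
  have hinter : hull P s ∩ hull P t ⊆ hull P (s ∩ t) := by
    rcases eq_or_ne s t with rfl | hst
    · simp
    have hsub := hface.imp (S := fun s t => hull P s ∩ hull P t ⊆ hull P (s ∩ t))
      (fun h => hull_inter_subset_of_meetInFace h)
    have : Std.Symm fun s t => hull P s ∩ hull P t ⊆ hull P (s ∩ t) :=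
      ⟨fun s t h => by rwa [Set.inter_comm, Finset.inter_comm]⟩
    exact hsub.forall hs ht hst
  refine ⟨(s ∩ t).image (realPoint P), Finset.image_subset_image Finset.inter_subset_left,
    Finset.image_subset_image Finset.inter_subset_right, ?_⟩
  simp only [Finset.coe_image]
  exact hinter.antisymm (Set.subset_inter (hull_mono Finset.inter_subset_left)
    (hull_mono Finset.inter_subset_right))

end IntegerConfigurations

/-! ### Dual certificates in integers -/

section DualCertificates

/-- The total weight of the sample points inside the tetrahedron `a b c d`. A sample point
`(q, w, y)` stands for the point `w⁻¹ • q` with weight `y`. -/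
def tetrahedronWeight (L : List ((Fin 3 → ℤ) × ℤ × ℤ)) (a b c d : Fin 3 → ℤ) : ℤ :=
  (L.map fun q => if 0 < depth a b c d q.1 q.2.1 then q.2.2 else 0).sum

variable {n : ℕ} {P : Fin n → Fin 3 → ℤ}

theorem IsFullSimplex.exists_index {σ : Finset (Fin 3 → ℝ)}
    (hP : Function.Injective P) (h : IsFullSimplex (Set.range (realPoint P)) σ) :
    ∃ a b c d : Fin n, a < b ∧ b < c ∧ c < d ∧ orient (P a) (P b) (P c) (P d) 1 ≠ 0 ∧
      σ = ({a, b, c, d} : Finset (Fin n)).image (realPoint P) := by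
  obtain ⟨s, hs⟩ : ∃ s : Finset (Fin n), s.image (realPoint P) = σ := by
    refine ⟨Finset.univ.filter (realPoint P · ∈ σ), Finset.ext fun x => ?_⟩
    simp only [Finset.mem_image, Finset.mem_filter, Finset.mem_univ, true_and]
    constructor
    · rintro ⟨i, hi, rfl⟩; exact hi
    · intro hx
      obtain ⟨i, rfl⟩ := h.subset hx
      exact ⟨i, hx, rfl⟩
  have hcard : s.card = 4 := by
    rw [← Finset.card_image_of_injective s (realPoint_injective hP), hs, h.card_eq]
  let e := s.orderEmbOfFin hcard
  have hse : s = {e 0, e 1, e 2, e 3} := by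
    ext i
    have : i ∈ Set.range e ↔ i ∈ s := by rw [s.range_orderEmbOfFin hcard, Finset.mem_coe]
    rw [← this, Set.mem_range]
    simp [Fin.exists_fin_succ, eq_comm]
  have hlt : ∀ i j : Fin 4, i < j → e i < e j := fun i j hij => e.strictMono hij
  refine ⟨e 0, e 1, e 2, e 3, hlt _ _ (by decide), hlt _ _ (by decide), hlt _ _ (by decide), ?_,
    by rw [← hse, hs]⟩
  have := h.orient_ne_zero (a := realPoint P (e 0)) (b := realPoint P (e 1))
    (c := realPoint P (e 2)) (d := realPoint P (e 3)) (by rw [← hs, hse]; simp)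
  rw [orient_realPoint] at this
  exact_mod_cast this

/-- A dual certificate in integers: the sample points `(q, w, y)` of the list `L` lie on the
boundary of no tetrahedron of the configuration, and they give every tetrahedron a weight at least
`N`, with equality only for tetrahedra of the list `S`. -/
def IsDualCertificate (P : Fin n → Fin 3 → ℤ) (S : List (Finset (Fin n)))
    (L : List ((Fin 3 → ℤ) × ℤ × ℤ)) (N : ℤ) : Prop :=
  (L.map fun q => q.2.2).sum = N * S.length ∧
  (∀ q ∈ L, 0 < q.2.1 ∧ ∃ a b c d, 0 < depth (P a) (P b) (P c) (P d) q.1 q.2.1) ∧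
  ∀ a b, a < b → ∀ c, b < c → ∀ d, c < d → orient (P a) (P b) (P c) (P d) 1 = 0 ∨
    ((∀ q ∈ L, depth (P a) (P b) (P c) (P d) q.1 q.2.1 ≠ 0) ∧
    N ≤ tetrahedronWeight L (P a) (P b) (P c) (P d) ∧
    (tetrahedronWeight L (P a) (P b) (P c) (P d) = N → {a, b, c, d} ∈ S))

instance (P : Fin n → Fin 3 → ℤ) (S : List (Finset (Fin n))) (L : List ((Fin 3 → ℤ) × ℤ × ℤ))
    (N : ℤ) : Decidable (IsDualCertificate P S L N) := by
  unfold IsDualCertificate; infer_instance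

theorem IsDualCertificate.card_le_and_eq {S : List (Finset (Fin n))}
    {L : List ((Fin 3 → ℤ) × ℤ × ℤ)} {N : ℤ} (h : IsDualCertificate P S L N)
    (hP : Function.Injective P) (hS : S.Nodup) {D : Finset (Finset (Fin 3 → ℝ))}
    (hD : IsDissection (Set.range (realPoint P)) D) :
    N * D.card ≤ N * S.length ∧ (D.card = S.length → D = realize P S) := by
  obtain ⟨hsum, hmem, hweight⟩ := h
  let pt : (Fin 3 → ℤ) × ℤ × ℤ → Fin 3 → ℝ := fun q k => (q.1 k : ℝ) / (q.2.1 : ℝ)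
  have hdepth : ∀ q ∈ L, ∀ a b c d, depth (realPoint P a) (realPoint P b) (realPoint P c)
      (realPoint P d) (pt q) 1 =
        (depth (P a) (P b) (P c) (P d) q.1 q.2.1 : ℤ) / (q.2.1 : ℝ) := fun q hq a b c d => by
    rw [← depth_realPoint, ← depth_div (by exact_mod_cast (hmem q hq).1)]
  have hpos : ∀ q ∈ L, ∀ a b c d, 0 < depth (P a) (P b) (P c) (P d) q.1 q.2.1 →
      0 < depth (realPoint P a) (realPoint P b) (realPoint P c) (realPoint P d) (pt q) 1 :=
    fun q hq a b c d h => by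
      rw [hdepth q hq]
      exact div_pos (by exact_mod_cast h) (by exact_mod_cast (hmem q hq).1)
  have hin : ∀ q ∈ L, ∀ a b c d, pt q ∈ convexHull ℝ
      {realPoint P a, realPoint P b, realPoint P c, realPoint P d} →
      0 ≤ depth (P a) (P b) (P c) (P d) q.1 q.2.1 := fun q hq a b c d h => by
    have h1 := depth_nonneg_of_mem h
    have h2 : (0 : ℝ) < (q.2.1 : ℝ) := by exact_mod_cast (hmem q hq).1
    rw [hdepth q hq, le_div_iff₀ h2, zero_mul] at h1
    exact_mod_cast h1
  have hcoe : ∀ a b c d : Fin n, (((({a, b, c, d} : Finset (Fin n)).image (realPoint P) :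
      Finset (Fin 3 → ℝ))) : Set (Fin 3 → ℝ)) =
      {realPoint P a, realPoint P b, realPoint P c, realPoint P d} := fun a b c d => by
    simp
  have key := hD.card_le_and_eq_of_sampleWeight (D₀ := realize P S) (N := N)
    (L := L.map fun q => (pt q, q.2.2)) ?_ ?_ ?_ ?_
  · rwa [card_realize hP hS] at key
  · simp only [List.mem_map, forall_exists_index, and_imp]
    rintro _ q hq rfl
    obtain ⟨-, a, b, c, d, h⟩ := hmem q hq
    refine convexHull_mono ?_ (mem_convexHull_of_depth_pos (hpos q hq a b c d h))
    rintro _ (rfl | rfl | rfl | rfl) <;> exact ⟨_, rfl⟩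
  · simp only [List.mem_map, forall_exists_index, and_imp]
    rintro _ q hq rfl σ hσ hqσ
    obtain ⟨a, b, c, d, hab, hbc, hcd, hne, rfl⟩ := hσ.exists_index hP
    rw [hcoe] at hqσ ⊢
    exact mem_interior_of_depth_pos (hpos q hq a b c d (lt_of_le_of_ne (hin q hq a b c d hqσ)
      (((hweight a b hab c hbc d hcd).resolve_left hne).1 q hq).symm))
  · intro σ hσ
    obtain ⟨a, b, c, d, hab, hbc, hcd, hne, rfl⟩ := hσ.exists_index hP
    obtain ⟨hgen, hN, heq⟩ := (hweight a b hab c hbc d hcd).resolve_left hne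
    have hW : sampleWeight (L.map fun q => (pt q, q.2.2))
        (({a, b, c, d} : Finset (Fin n)).image (realPoint P)) =
        tetrahedronWeight L (P a) (P b) (P c) (P d) := by
      rw [sampleWeight, tetrahedronWeight, List.map_map]
      congr 1
      classical
      refine List.map_congr_left fun q hq => ?_
      simp only [Function.comp_apply, hcoe]
      refine if_congr ⟨fun h => ?_, fun h => ?_⟩ rfl rfl
      · exact lt_of_le_of_ne (hin q hq a b c d h) (hgen q hq).symm
      · exact mem_convexHull_of_depth_pos (hpos q hq a b c d h)
    rw [hW]
    exact ⟨hN, fun h => mem_realize.2 ⟨_, heq h, rfl⟩⟩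
  · rw [card_realize hP hS, ← hsum, List.map_map]
    rfl

end DualCertificates

/-! ### Vertices of polytopes -/

section Polytopes

variable {n : ℕ} {P : Fin n → Fin 3 → ℤ}

theorem isPolytopeVertexSet_range (hP : Function.Injective P)
    (hext : ∀ i, ∃ f : Fin 4 → ℤ, affineForm f (P i) = 0 ∧ ∀ j, j ≠ i → affineForm f (P j) < 0)
    (hfull : ∃ a b c d, orient (P a) (P b) (P c) (P d) 1 ≠ 0) :
    IsPolytopeVertexSet (Set.range (realPoint P)) n := by
  have hhull : convexHull ℝ (Set.range (realPoint P)) = hull P Finset.univ := by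
    rw [hull, Finset.coe_univ, Set.image_univ]
  refine ⟨?_, ?_, ?_⟩
  · rw [← Set.image_univ, (realPoint_injective hP).encard_image, Set.encard_univ]
    simp
  · refine Set.Subset.antisymm extremePoints_convexHull_subset ?_
    rintro _ ⟨i, rfl⟩
    obtain ⟨f, hfi, hf⟩ := hext i
    have hle : ∀ j ∈ Finset.univ, linearForm f (realPoint P j) ≤ -f 3 := fun j _ =>
      linearForm_le_iff.2 (by
        rcases eq_or_ne j i with rfl | h
        · exact hfi.le
        · exact (hf j h).le)
    -- the supporting plane meets the polytope in the vertex only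
    have honly : ∀ x ∈ hull P Finset.univ, -f 3 ≤ linearForm f x → x = realPoint P i := by
      classical
      intro x hx hfx
      have := mem_convexHull_filter_of_le hle hx hfx
      simp only [linearForm_eq_iff] at this
      have hset : (Finset.univ.filter fun j => affineForm f (P j) = 0) = {i} := by
        ext j
        simp only [Finset.mem_filter, Finset.mem_univ, true_and, Finset.mem_singleton]
        refine ⟨fun h => by_contra fun hne => (hf j hne).ne h, ?_⟩
        rintro rfl; exact hfi
      rw [hset] at this
      simpa using this
    rw [hhull, mem_extremePoints]
    have hi : realPoint P i ∈ hull P Finset.univ := subset_convexHull ℝ _ ⟨i, by simp, rfl⟩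
    refine ⟨hi, fun y hy z hz hyz => ?_⟩
    obtain ⟨r, s, hr, hs, hrs, hyz⟩ := hyz
    have h1 := le_of_mem_convexHull_image hle hy
    have h2 := le_of_mem_convexHull_image hle hz
    have h3 := linearForm_eq_iff.2 hfi
    rw [← hyz, map_add, map_smul, map_smul, smul_eq_mul, smul_eq_mul] at h3
    obtain rfl : s = 1 - r := by linarith
    refine ⟨honly y hy ?_, honly z hz ?_⟩ <;> nlinarith
  · obtain ⟨a, b, c, d, h⟩ := hfull
    have hi : AffineIndependent ℝ
        ![realPoint P a, realPoint P b, realPoint P c, realPoint P d] :=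
      affineIndependent_of_orient_ne_zero (by rw [orient_realPoint]; exact_mod_cast h)
    have htop := hi.affineSpan_eq_top_iff_card_eq_finrank_add_one.2 (by simp)
    refine top_unique (htop.ge.trans (affineSpan_mono ℝ ?_))
    rintro _ ⟨i, rfl⟩
    fin_cases i <;> exact ⟨_, rfl⟩

theorem affineForm_le_of_mem_convexHull {f : Fin 4 → ℤ} (hf : ∀ i, affineForm f (P i) ≤ 0)
    {m : Fin 3 → ℤ} (hm : (fun k => (m k : ℝ)) ∈ convexHull ℝ (Set.range (realPoint P))) :
    affineForm f m ≤ 0 := by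
  have hm' : realPoint (fun _ : Unit => m) () ∈ hull P Finset.univ := by
    rwa [hull, Finset.coe_univ, Set.image_univ]
  exact linearForm_le_iff.1 (le_of_mem_convexHull_image (fun i _ => linearForm_le_iff.2 (hf i)) hm')

end Polytopes

/-! ### Volumes of unimodular tetrahedra -/

section Volume

theorem IsDissection.sum_volume {d : ℕ} {A : Set (Fin d → ℝ)} {D : Finset (Finset (Fin d → ℝ))}
    (hD : IsDissection A D) :
    volume (convexHull ℝ A) = ∑ σ ∈ D, volume (convexHull ℝ (σ : Set (Fin d → ℝ))) := by
  rw [← hD.iUnion_eq]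
  refine measure_biUnion_finset₀ (fun σ hσ τ hτ hne => ?_)
    (fun σ _ => (convex_convexHull ℝ _).nullMeasurableSet volume)
  -- a common point that is not interior to both simplices lies on the boundary of one of them
  refine measure_mono_null (t := frontier (convexHull ℝ (σ : Set (Fin d → ℝ))) ∪
    frontier (convexHull ℝ (τ : Set (Fin d → ℝ)))) ?_
    (measure_union_null ((convex_convexHull ℝ _).addHaar_frontier _)
      ((convex_convexHull ℝ _).addHaar_frontier _))
  rintro x ⟨hσx, hτx⟩
  by_contra hx
  rw [Set.mem_union, not_or] at hx
  exact Set.disjoint_left.1 (hD.disjoint_interior σ hσ τ hτ hne)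
    (by_contra fun h => hx.1 ⟨subset_closure hσx, h⟩)
    (by_contra fun h => hx.2 ⟨subset_closure hτx, h⟩)

open scoped Pointwise in
theorem volume_convexHull_eq_mul (a b c d : Fin 3 → ℝ) :
    volume (convexHull ℝ {a, b, c, d}) = ENNReal.ofReal |orient a b c d 1| *
      volume (convexHull ℝ {(0 : Fin 3 → ℝ), ![1, 0, 0], ![0, 1, 0], ![0, 0, 1]}) := by
  let f : (Fin 3 → ℝ) →ₗ[ℝ] (Fin 3 → ℝ) :=
    Matrix.toLin' (Matrix.of ![b - a, c - a, d - a]).transpose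
  have hf : ∀ x, f x = x 0 • (b - a) + x 1 • (c - a) + x 2 • (d - a) := fun x => by
    ext k
    simp [f, Matrix.mulVec, dotProduct, Fin.sum_univ_succ]
    ring
  have hdet : |LinearMap.det f| = |orient a b c d 1| := by
    rw [LinearMap.det_toLin', Matrix.det_transpose, Matrix.det_fin_three]
    congr 1
    simp [orient]
    ring
  have himage : convexHull ℝ {a, b, c, d} = (fun y => a + y) ''
      (f '' convexHull ℝ {(0 : Fin 3 → ℝ), ![1, 0, 0], ![0, 1, 0], ![0, 0, 1]}) := by
    have h1 := f.image_convexHull {0, ![1, 0, 0], ![0, 1, 0], ![0, 0, 1]}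
    have h2 := convexHull_vadd (𝕜 := ℝ) a (f '' {0, ![1, 0, 0], ![0, 1, 0], ![0, 0, 1]})
    rw [h1]
    change convexHull ℝ {a, b, c, d} = a +ᵥ convexHull ℝ (f '' _)
    rw [← h2]
    congr 1
    simp [Set.image_insert_eq, hf, Set.vadd_set_insert, Set.vadd_set_singleton]
  rw [himage, Set.image_add_left, measure_preimage_add, Measure.addHaar_image_linearMap, hdet]

/-- A tetrahedron with vertices in `ℤ³` whose determinant is a unit has the volume of the standard
tetrahedron. -/
theorem IsTetrahedron.volume_eq {ι : Type*} [DecidableEq ι] {P : ι → Fin 3 → ℤ} {s : Finset ι}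
    (h : IsTetrahedron P s) (hunit : ∀ a ∈ s, ∀ b ∈ s, ∀ c ∈ s, ∀ d ∈ s,
      (orient (P a) (P b) (P c) (P d) 1).natAbs ≤ 1) :
    volume (convexHull ℝ ((s.image (realPoint P) : Finset (Fin 3 → ℝ)) : Set (Fin 3 → ℝ))) =
      volume (convexHull ℝ {(0 : Fin 3 → ℝ), ![1, 0, 0], ![0, 1, 0], ![0, 0, 1]}) := by
  obtain ⟨a, b, c, d, rfl, hD⟩ := h.exists_eq
  have h1 := hunit a (by simp) b (by simp) c (by simp) d (by simp)
  have habs : |orient (P a) (P b) (P c) (P d) 1| = 1 := by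
    rw [Int.abs_eq_natAbs]; omega
  have hcoe : (((({a, b, c, d} : Finset ι).image (realPoint P) :
      Finset (Fin 3 → ℝ))) : Set (Fin 3 → ℝ)) =
      {realPoint P a, realPoint P b, realPoint P c, realPoint P d} := by simp
  rw [hcoe, volume_convexHull_eq_mul, orient_realPoint, ← Int.cast_abs, habs]
  simp

/-- The vertices of the unit cube, in binary counting order. -/
def cubePoints : Fin 8 → Fin 3 → ℤ :=
  ![![0, 0, 0], ![1, 0, 0], ![0, 1, 0], ![1, 1, 0], ![0, 0, 1], ![1, 0, 1], ![0, 1, 1], ![1, 1, 1]]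

/-- The dissection of the cube into the six tetrahedra given by the orderings of the coordinates. -/
def cubeDissection : List (Finset (Fin 8)) :=
  [{0, 1, 3, 7}, {0, 1, 5, 7}, {0, 2, 3, 7}, {0, 2, 6, 7}, {0, 4, 5, 7}, {0, 4, 6, 7}]

/-- The planes on which two coordinates are equal. -/
def cubePlanes : List (Fin 4 → ℤ) :=
  [![1, -1, 0, 0], ![0, 1, -1, 0], ![1, 0, -1, 0]]

/-- Certificate that `cubeDissection` covers the cube. -/
def cubeDissectionCover : List (Finset (Fin 8) × (Fin 8 → ℤ)) :=
    [({0, 1, 2, 3, 4, 5, 6, 7}, ![-1, 1, 1, -1, 0, 0, 0, 0]),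
     ({0, 1, 3, 4, 5, 6, 7}, ![-1, 1, 0, 0, 0, 0, 1, -1]),
     ({0, 1, 3, 4, 5, 7}, ![-1, 0, 0, 1, 1, 0, 0, -1]),
     ({0, 1, 4, 5, 7}, ![-1, 1, 0, 0, 1, -1, 0, 0]),
     ({0, 2, 3, 4, 5, 6, 7}, ![-1, 0, 1, 0, 0, 1, 0, -1]),
     ({0, 2, 3, 4, 6, 7}, ![-1, 0, 0, 1, 1, 0, 0, -1]),
     ({0, 2, 4, 6, 7}, ![-1, 0, 1, 0, 1, 0, -1, 0]),
     ({0, 3, 4, 5, 6, 7}, ![0, 0, 0, 0, -1, 1, 1, -1]),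
     ({0, 3, 4, 5, 7}, ![-1, 0, 0, 1, 1, 0, 0, -1]),
     ({0, 1, 3, 5, 7}, ![0, -1, 0, 1, 0, 1, 0, -1]),
     ({0, 3, 4, 6, 7}, ![-1, 0, 0, 1, 1, 0, 0, -1]),
     ({0, 2, 3, 6, 7}, ![0, 0, -1, 1, 0, 0, 1, -1])]

theorem isDissection_cube :
    IsDissection (Set.range (realPoint cubePoints)) (realize cubePoints cubeDissection) :=
  isDissection_realize (F := cubePlanes) (L := cubeDissectionCover)
    (by decide +kernel) (by decide +kernel) (by decide +kernel)

theorem convexHull_cubePoints :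
    convexHull ℝ (Set.range (realPoint cubePoints)) = Set.Icc 0 1 := by
  have hrange : Set.range (realPoint cubePoints) =
      Set.univ.pi fun _ : Fin 3 => ({0, 1} : Set ℝ) := by
    ext x
    constructor
    · rintro ⟨i, rfl⟩ k -
      have : ∀ i k, cubePoints i k = 0 ∨ cubePoints i k = 1 := by decide
      rcases this i k with h | h <;> simp [realPoint, h]
    · intro hx
      have hx0 := hx 0 trivial
      have hx1 := hx 1 trivial
      have hx2 := hx 2 trivial
      have hbits : ∀ u v w : Fin 2, ∃ i, cubePoints i 0 = (u : ℕ) ∧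
        cubePoints i 1 = (v : ℕ) ∧ cubePoints i 2 = (w : ℕ) := by decide
      have hbit : ∀ y : ℝ, y ∈ ({0, 1} : Set ℝ) → ∃ u : Fin 2, y = ((u : ℕ) : ℝ) := by
        rintro y (rfl | rfl)
        · exact ⟨0, by simp⟩
        · exact ⟨1, by simp⟩
      obtain ⟨u, hu⟩ := hbit _ hx0
      obtain ⟨v, hv⟩ := hbit _ hx1
      obtain ⟨w, hw⟩ := hbit _ hx2
      obtain ⟨i, h0, h1, h2⟩ := hbits u v w
      refine ⟨i, ?_⟩
      ext k
      fin_cases k <;> simp [realPoint, h0, h1, h2, hu, hv, hw]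
  rw [hrange, convexHull_pi, ← Set.pi_univ_Icc]
  simp [convexHull_pair, segment_eq_Icc]

theorem volume_standardTetrahedron :
    volume (convexHull ℝ {(0 : Fin 3 → ℝ), ![1, 0, 0], ![0, 1, 0], ![0, 0, 1]}) =
      ENNReal.ofReal (1 / 6) := by
  have hvol := isDissection_cube.sum_volume
  have hterm : ∀ σ ∈ realize cubePoints cubeDissection,
      volume (convexHull ℝ (σ : Set (Fin 3 → ℝ))) =
        volume (convexHull ℝ {(0 : Fin 3 → ℝ), ![1, 0, 0], ![0, 1, 0], ![0, 0, 1]}) := by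
    intro σ hσ
    obtain ⟨s, hs, rfl⟩ := mem_realize.1 hσ
    exact ((by decide +kernel : ∀ s ∈ cubeDissection, IsTetrahedron cubePoints s) s hs).volume_eq
      ((by decide +kernel : ∀ s ∈ cubeDissection, ∀ a ∈ s, ∀ b ∈ s, ∀ c ∈ s, ∀ d ∈ s,
        (orient (cubePoints a) (cubePoints b) (cubePoints c) (cubePoints d) 1).natAbs ≤ 1) s hs)
  have hcube : volume (Set.Icc (0 : Fin 3 → ℝ) 1) = 1 := by
    rw [Real.volume_Icc_pi]; simp
  rw [Finset.sum_congr rfl hterm, Finset.sum_const, convexHull_cubePoints, hcube,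
    card_realize (by decide) (by decide), nsmul_eq_mul] at hvol
  rw [ENNReal.ofReal_div_of_pos (by norm_num), ENNReal.ofReal_one,
    ENNReal.eq_div_iff (by norm_num) (by norm_num), hvol]
  norm_num [cubeDissection]

end Volume

/-! ### Triangulations next to a unique extremal dissection -/

section Extremal

variable {α : Type*}

theorem two_lt_encard_of_injective {s : Set α} {g : Fin 3 → α} (hg : Function.Injective g)
    (hs : ∀ j, g j ∈ s) : 2 < s.encard := by
  have h3 : (Set.range g).encard = 3 := by
    rw [← Set.image_univ, hg.encard_image, Set.encard_univ]; simp
  calc (2 : ℕ∞) < 3 := by norm_num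
    _ = (Set.range g).encard := h3.symm
    _ ≤ s.encard := Set.encard_le_encard (Set.range_subset_iff.2 hs)

variable {d m : ℕ} {A : Set (Fin d → ℝ)} {D₀ : Finset (Finset (Fin d → ℝ))}
  {T : Fin 3 → Finset (Finset (Fin d → ℝ))}

theorem isMaxDissection_and_unique (hD₀ : IsDissection A D₀) (hcard : D₀.card = m)
    (hle : ∀ D, IsDissection A D → D.card ≤ m)
    (huniq : ∀ D, IsDissection A D → D.card = m → D = D₀) :
    IsMaxDissection A D₀ ∧ ∀ D, IsMaxDissection A D → D = D₀ :=
  ⟨⟨hD₀, fun D hD => (hle D hD).trans hcard.ge⟩, fun D hD =>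
    huniq D hD.1 (le_antisymm (hle D hD.1) (hcard.ge.trans (hD.2 _ hD₀)))⟩

theorem isMinDissection_and_unique (hD₀ : IsDissection A D₀) (hcard : D₀.card = m)
    (hle : ∀ D, IsDissection A D → m ≤ D.card)
    (huniq : ∀ D, IsDissection A D → D.card = m → D = D₀) :
    IsMinDissection A D₀ ∧ ∀ D, IsMinDissection A D → D = D₀ :=
  ⟨⟨hD₀, fun D hD => hcard.le.trans (hle D hD)⟩, fun D hD =>
    huniq D hD.1 (le_antisymm ((hD.2 _ hD₀).trans hcard.le) (hle D hD.1))⟩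

/-- If the only dissection of size at least `m + 1` is not a triangulation, then the triangulations
of size `m` are the maximal ones. -/
theorem several_isMaxTriangulation (hle : ∀ D, IsDissection A D → D.card ≤ m + 1)
    (huniq : ∀ D, IsDissection A D → D.card = m + 1 → D = D₀) (hD₀ : ¬ IsTriangulation A D₀)
    (hT : ∀ j, IsTriangulation A (T j)) (hcard : ∀ j, (T j).card = m)
    (hinj : Function.Injective T) :
    2 < {T | IsMaxTriangulation A T}.encard ∧ ∀ T, IsMaxTriangulation A T → T.card = m := by
  have hle' : ∀ T, IsTriangulation A T → T.card ≤ m := fun T hT => by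
    have hne : T.card ≠ m + 1 := fun h => hD₀ (huniq T hT.toIsDissection h ▸ hT)
    have := hle T hT.toIsDissection
    omega
  refine ⟨two_lt_encard_of_injective hinj
    fun j => ⟨hT j, fun T' hT' => (hle' T' hT').trans (hcard j).ge⟩, fun T' hT' => ?_⟩
  exact le_antisymm (hle' T' hT'.1) ((hcard 0).ge.trans (hT'.2 _ (hT 0)))

/-- If the only dissection of size at most `m` is not a triangulation, then the triangulations
of size `m + 1` are the minimal ones. -/
theorem several_isMinTriangulation (hle : ∀ D, IsDissection A D → m ≤ D.card)
    (huniq : ∀ D, IsDissection A D → D.card = m → D = D₀) (hD₀ : ¬ IsTriangulation A D₀)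
    (hT : ∀ j, IsTriangulation A (T j)) (hcard : ∀ j, (T j).card = m + 1)
    (hinj : Function.Injective T) :
    2 < {T | IsMinTriangulation A T}.encard ∧ ∀ T, IsMinTriangulation A T → T.card = m + 1 := by
  have hle' : ∀ T, IsTriangulation A T → m + 1 ≤ T.card := fun T hT => by
    have hne : T.card ≠ m := fun h => hD₀ (huniq T hT.toIsDissection h ▸ hT)
    have := hle T hT.toIsDissection
    omega
  refine ⟨two_lt_encard_of_injective hinj
    fun j => ⟨hT j, fun T' hT' => (hcard j).le.trans (hle' T' hT')⟩, fun T' hT' => ?_⟩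
  exact le_antisymm ((hT'.2 _ (hT 0)).trans (hcard 0).le) (hle' T' hT'.1)

theorem injective_realize {n : ℕ} {P : Fin n → Fin 3 → ℤ} {S : Fin 3 → List (Finset (Fin n))}
    (hP : Function.Injective P) (hS : Function.Injective fun j => (S j).toFinset) :
    Function.Injective fun j => realize P (S j) :=
  fun _ _ h => hS (realize_inj hP h)

end Extremal

/-! ### Certificates for the lattice polytope -/

/-- The points `s, e, w, n, v₁, v₂, u₁, u₂` of the lattice polytope. -/
def latticePoints : Fin 8 → Fin 3 → ℤ :=
  ![![0, 0, 0], ![1, 0, 0], ![0, 1, 0], ![1, 1, 0], ![-1, 0, 1], ![1, 1, 1], ![0, 1, -1],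
   ![2, 0, -1]]

/-- Planes that separate the simplices of the dissections of the lattice polytope below. -/
def latticePlanes : List (Fin 4 → ℤ) :=
  [![0, 0, 1, 0], ![1, 0, 0, 0], ![1, 0, 1, -1], ![1, 0, 0, -1], ![1, 0, 1, 0], ![1, -2, 1, 0],
   ![1, 2, 0, -2], ![0, 1, -1, 0], ![0, 1, 1, 0], ![1, -1, 0, 0], ![0, 1, -1, -1], ![1, 1, 1, -1],
   ![1, 0, -1, 0], ![1, -1, -1, 0], ![1, 0, 2, 0], ![1, 2, 1, -1], ![0, 1, 1, -1], ![1, -1, 1, 0],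
   ![1, 0, -1, -1], ![1, 1, 0, -1], ![1, -2, 0, 1], ![1, -1, 2, 0], ![1, 1, -1, -1]]

/-- The unique maximal dissection of the lattice polytope. -/
def latticeMaxDissection : List (Finset (Fin 8)) :=
  [{0, 1, 2, 6}, {0, 1, 3, 5}, {0, 1, 4, 5}, {0, 1, 6, 7}, {0, 2, 3, 4}, {0, 2, 4, 6},
   {0, 3, 4, 5}, {1, 2, 3, 7}, {1, 2, 6, 7}, {1, 3, 5, 7}, {2, 3, 4, 5}, {2, 3, 6, 7}]

/-- Certificate that `latticeMaxDissection` covers the polytope. -/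
def latticeMaxDissectionCover : List (Finset (Fin 8) × (Fin 8 → ℤ)) :=
  [({0, 1, 2, 3, 4, 5, 6, 7}, ![-1, -1, 0, 0, 1, 0, 0, 1]),
   ({0, 1, 2, 3, 4, 5, 6}, ![0, 0, -1, -1, 0, 1, 1, 0]),
   ({0, 1, 2, 3, 4, 5}, ![-1, 1, 1, -1, 0, 0, 0, 0]),
   ({0, 1, 2, 3, 4, 6}, ![-2, 1, -1, 0, 1, 0, 1, 0]),
   ({0, 1, 2, 3, 4}, ![-1, 1, 1, -1, 0, 0, 0, 0]),
   ({0, 1, 3, 4, 5}, ![-2, 1, 0, 1, 1, -1, 0, 0]),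
   ({0, 2, 3, 4, 6}, ![-1, 0, -2, 1, 1, 0, 1, 0]),
   ({0, 1, 2, 3, 6}, ![1, -1, -1, 1, 0, 0, 0, 0]),
   ({0, 1, 2, 3, 5, 6, 7}, ![0, 0, -1, -1, 0, 1, 1, 0]),
   ({0, 1, 2, 3, 5, 7}, ![2, -3, -1, 0, 0, 1, 0, 1]),
   ({0, 1, 2, 3, 7}, ![1, -1, -1, 1, 0, 0, 0, 0]),
   ({1, 2, 3, 5, 7}, ![0, -1, 1, -2, 0, 1, 0, 1]),
   ({0, 1, 2, 3, 5}, ![-1, 1, 1, -1, 0, 0, 0, 0]),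
   ({0, 2, 3, 4, 5}, ![1, 0, 1, -2, -1, 1, 0, 0]),
   ({0, 1, 2, 3, 6, 7}, ![1, -1, -1, 1, 0, 0, 0, 0]),
   ({0, 1, 2, 6, 7}, ![1, -2, 1, 0, 0, 0, -1, 1]),
   ({1, 2, 3, 6, 7}, ![0, 1, -2, 1, 0, 0, 1, -1])]

/-- Sample points and weights of the dual certificate for `latticeMaxDissection`. -/
def latticeMaxSamples : List ((Fin 3 → ℤ) × ℤ × ℤ) :=
  [(![4, 2, 3], 8, -2), (![7, 6, -3], 8, -3), (![-2, 4, -1], 11, 3), (![8, 2, -5], 12, -10),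
   (![12, 7, 1], 10, -1), (![3, 9, 5], 11, -3), (![15, 10, 2], 14, 5), (![13, 3, 4], 22, -1),
   (![1, 20, -6], 23, -1), (![-1, 10, -2], 14, -3), (![10, 15, -2], 16, 7), (![8, 21, 7], 23, -2),
   (![7, 3, -5], 9, 7), (![20, 5, 2], 21, -3), (![8, 1, -2], 18, 5), (![12, 14, 4], 15, 1),
   (![-2, 13, 5], 19, 6), (![10, 4, 3], 12, 7), (![9, 2, -4], 17, 2), (![2, 4, -3], 12, 5),
   (![22, 14, -3], 20, 1), (![19, 10, -5], 16, 3), (![6, 16, 3], 18, 8), (![7, 5, -6], 9, 4),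
   (![1, 4, 6], 9, 4), (![-1, 5, -2], 8, 4), (![5, 1, 2], 11, 7), (![-2, 2, 3], 12, -2)]

/-- Three maximal triangulations of the lattice polytope. -/
def latticeMaxTriangulation : Fin 3 → List (Finset (Fin 8)) :=
  ![[{0, 1, 2, 5}, {0, 1, 2, 6}, {0, 1, 4, 5}, {0, 1, 6, 7}, {0, 2, 4, 5}, {0, 2, 4, 6},
     {1, 2, 3, 5}, {1, 2, 3, 7}, {1, 2, 6, 7}, {1, 3, 5, 7}, {2, 3, 6, 7}],
    [{0, 1, 3, 5}, {0, 1, 3, 6}, {0, 1, 4, 5}, {0, 1, 6, 7}, {0, 2, 3, 4}, {0, 2, 3, 6},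
     {0, 2, 4, 6}, {0, 3, 4, 5}, {1, 3, 5, 7}, {1, 3, 6, 7}, {2, 3, 4, 5}],
    [{0, 1, 3, 5}, {0, 1, 3, 7}, {0, 1, 4, 5}, {0, 2, 3, 4}, {0, 2, 3, 7}, {0, 2, 4, 6},
     {0, 2, 6, 7}, {0, 3, 4, 5}, {1, 3, 5, 7}, {2, 3, 4, 5}, {2, 3, 6, 7}]]

/-- Certificates that the triangulations `latticeMaxTriangulation` cover the polytope. -/
def latticeMaxTriangulationCover : Fin 3 → List (Finset (Fin 8) × (Fin 8 → ℤ)) :=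
  ![[({0, 1, 2, 3, 4, 5, 6, 7}, ![-1, -1, 0, 0, 1, 0, 0, 1]),
     ({0, 1, 2, 3, 4, 5, 6}, ![0, 0, -1, -1, 0, 1, 1, 0]),
     ({0, 1, 2, 3, 4, 6}, ![-1, 0, -2, 1, 1, 0, 1, 0]),
     ({0, 1, 2, 3, 4, 5}, ![-1, 0, -1, 2, 1, -1, 0, 0]),
     ({0, 1, 2, 3, 5}, ![1, -1, -1, 1, 0, 0, 0, 0]),
     ({0, 1, 2, 3, 6}, ![1, -1, -1, 1, 0, 0, 0, 0]),
     ({0, 1, 2, 4, 6}, ![-2, 1, -1, 0, 1, 0, 1, 0]),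
     ({0, 1, 2, 4, 5}, ![-3, 2, 1, 0, 1, -1, 0, 0]),
     ({0, 1, 2, 3, 5, 6, 7}, ![0, 0, -1, -1, 0, 1, 1, 0]),
     ({0, 1, 2, 3, 5, 7}, ![1, -1, -1, 1, 0, 0, 0, 0]),
     ({0, 1, 2, 5, 7}, ![2, -3, -1, 0, 0, 1, 0, 1]),
     ({1, 2, 3, 5, 7}, ![0, -1, 1, -2, 0, 1, 0, 1]),
     ({0, 1, 2, 3, 6, 7}, ![1, -1, -1, 1, 0, 0, 0, 0]),
     ({0, 1, 2, 6, 7}, ![1, -2, 1, 0, 0, 0, -1, 1]),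
     ({1, 2, 3, 6, 7}, ![0, 1, -2, 1, 0, 0, 1, -1])],
    [({0, 1, 2, 3, 4, 5, 6, 7}, ![-1, -1, 0, 0, 1, 0, 0, 1]),
     ({0, 1, 2, 3, 4, 5, 6}, ![0, 0, -1, -1, 0, 1, 1, 0]),
     ({0, 1, 2, 3, 4, 5}, ![-1, 1, 1, -1, 0, 0, 0, 0]),
     ({0, 1, 2, 3, 4, 6}, ![-1, 1, 1, -1, 0, 0, 0, 0]),
     ({0, 1, 3, 4, 6}, ![-3, 2, 0, -1, 1, 0, 1, 0]),
     ({0, 1, 3, 4, 5}, ![-2, 1, 0, 1, 1, -1, 0, 0]),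
     ({0, 2, 3, 4, 6}, ![-1, 0, -2, 1, 1, 0, 1, 0]),
     ({0, 1, 2, 3, 5, 6, 7}, ![0, 0, -1, -1, 0, 1, 1, 0]),
     ({0, 1, 2, 3, 5, 7}, ![-1, 0, 2, -3, 0, 1, 0, 1]),
     ({0, 1, 2, 3, 5}, ![-1, 1, 1, -1, 0, 0, 0, 0]),
     ({0, 2, 3, 4, 5}, ![1, 0, 1, -2, -1, 1, 0, 0]),
     ({0, 1, 3, 5, 7}, ![1, -2, 0, -1, 0, 1, 0, 1]),
     ({0, 1, 2, 3, 6, 7}, ![-1, 0, 3, -2, 0, 0, -1, 1]),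
     ({0, 1, 2, 3, 6}, ![-1, 1, 1, -1, 0, 0, 0, 0]),
     ({0, 1, 3, 6, 7}, ![2, -3, 0, 1, 0, 0, -1, 1])],
    [({0, 1, 2, 3, 4, 5, 6, 7}, ![-1, -1, 0, 0, 1, 0, 0, 1]),
     ({0, 1, 2, 3, 4, 5, 6}, ![0, 0, -1, -1, 0, 1, 1, 0]),
     ({0, 1, 2, 3, 4, 5}, ![-1, 1, 1, -1, 0, 0, 0, 0]),
     ({0, 1, 2, 3, 4, 6}, ![-2, 1, -1, 0, 1, 0, 1, 0]),
     ({0, 1, 2, 3, 4}, ![-1, 1, 1, -1, 0, 0, 0, 0]),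
     ({0, 1, 3, 4, 5}, ![-2, 1, 0, 1, 1, -1, 0, 0]),
     ({0, 2, 3, 4, 6}, ![-1, 0, -2, 1, 1, 0, 1, 0]),
     ({0, 1, 2, 3, 5, 6, 7}, ![0, 0, -1, -1, 0, 1, 1, 0]),
     ({0, 1, 2, 3, 5, 7}, ![-1, 1, 1, -1, 0, 0, 0, 0]),
     ({0, 2, 3, 5, 7}, ![-1, 0, 2, -3, 0, 1, 0, 1]),
     ({0, 2, 3, 4, 5}, ![1, 0, 1, -2, -1, 1, 0, 0]),
     ({0, 1, 3, 5, 7}, ![1, -2, 0, -1, 0, 1, 0, 1]),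
     ({0, 1, 2, 3, 6, 7}, ![-1, 2, -1, 0, 0, 0, 1, -1]),
     ({0, 1, 2, 3, 7}, ![-1, 1, 1, -1, 0, 0, 0, 0]),
     ({0, 2, 3, 6, 7}, ![1, 0, -3, 2, 0, 0, 1, -1])]]

/-- For each vertex of the lattice polytope, an affine form that vanishes there and is negative at
the other vertices. -/
def latticeSupports : Fin 8 → Fin 4 → ℤ :=
  ![![-2, -4, -3, 0], ![2, -4, 3, -2], ![-2, 4, 1, -4], ![2, 4, -1, -6], ![-1, 0, 0, -1],
    ![0, 1, 1, -2], ![-1, 0, -1, -1], ![0, -1, -1, -1]]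

/-- The ten facets of the lattice polytope. -/
def latticeFacets : List (Fin 4 → ℤ) :=
  [![-1, -2, -2, 0], ![-1, -1, -1, 0], ![-1, 1, 0, -1], ![-1, 2, 1, -2], ![0, -1, 0, 0],
   ![0, 1, 0, -1], ![1, -2, 2, -1], ![1, -1, 1, -1], ![1, 1, 0, -2], ![1, 2, -1, -3]]

/-! ### The lattice polytope -/

theorem latticePoints_injective : Function.Injective latticePoints := by decide

theorem range_latticePoints : Set.range (realPoint latticePoints) = latticePolytopeVertices := by
  have h : realPoint latticePoints = ![![0, 0, 0], ![1, 0, 0], ![0, 1, 0], ![1, 1, 0], ![-1, 0, 1],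
      ![1, 1, 1], ![0, 1, -1], ![2, 0, -1]] := by
    ext i k
    fin_cases i <;> fin_cases k <;> simp [realPoint, latticePoints]
  rw [h, latticePolytopeVertices]
  ext x
  simp only [Matrix.range_cons, Matrix.range_empty, Set.union_empty, Set.mem_union,
    Set.mem_singleton_iff, Set.mem_insert_iff]

theorem lattice_isPolytopeVertexSet : IsPolytopeVertexSet latticePolytopeVertices 8 := by
  rw [← range_latticePoints]
  -- supporting planes at the eight vertices
  have hext : ∀ i, affineForm (latticeSupports i) (latticePoints i) = 0 ∧
      ∀ j, j ≠ i → affineForm (latticeSupports i) (latticePoints j) < 0 := by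
    decide +kernel
  exact isPolytopeVertexSet_range latticePoints_injective (fun i => ⟨_, hext i⟩) (by decide +kernel)

theorem latticeMaxDissection_isDissection :
    IsDissection latticePolytopeVertices (realize latticePoints latticeMaxDissection) := by
  rw [← range_latticePoints]
  exact isDissection_realize (F := latticePlanes) (L := latticeMaxDissectionCover)
    (by decide +kernel) (by decide +kernel) (by decide +kernel)

theorem lattice_dissection_card_le {D : Finset (Finset (Fin 3 → ℝ))}
    (hD : IsDissection latticePolytopeVertices D) :
    D.card ≤ 12 ∧ (D.card = 12 → D = realize latticePoints latticeMaxDissection) := by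
  rw [← range_latticePoints] at hD
  have hcert : IsDualCertificate latticePoints latticeMaxDissection latticeMaxSamples (4) := by
    decide +kernel
  obtain ⟨hle, heq⟩ := hcert.card_le_and_eq latticePoints_injective (by decide) hD
  have hlen : latticeMaxDissection.length = 12 := rfl
  rw [hlen] at hle heq
  exact ⟨by omega, heq⟩

theorem card_latticeMaxDissection : (realize latticePoints latticeMaxDissection).card = 12 :=
  card_realize latticePoints_injective (by decide)

theorem latticeMaxTriangulation_isTriangulation (j : Fin 3) :
    IsTriangulation latticePolytopeVertices
      (realize latticePoints (latticeMaxTriangulation j)) := by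
  rw [← range_latticePoints]
  have htet : ∀ j, ∀ s ∈ latticeMaxTriangulation j, IsTetrahedron latticePoints s := by
    decide +kernel
  have hsep : ∀ j, (latticeMaxTriangulation j).Pairwise
      (AreSeparated latticePoints latticePlanes) := by
    decide +kernel
  have hcov : ∀ j, coveredBy latticePoints (latticeMaxTriangulation j)
      (latticeMaxTriangulationCover j) Finset.univ = true := by decide +kernel
  -- each cut lowers the dimension of the span of the two vertex sets, so three cuts suffice
  have hface : ∀ j, (latticeMaxTriangulation j).Pairwise fun s t =>
      meetInFace latticePoints latticePlanes 3 s t = true := by decide +kernel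
  exact isTriangulation_realize (isDissection_realize (htet j) (hsep j) (hcov j)) (hface j)

theorem card_latticeMaxTriangulation (j : Fin 3) :
    (realize latticePoints (latticeMaxTriangulation j)).card = 11 := by
  have hnodup : ∀ j, (latticeMaxTriangulation j).Nodup := by decide +kernel
  rw [card_realize latticePoints_injective (hnodup j)]
  fin_cases j <;> rfl

theorem latticeMaxDissection_not_isTriangulation :
    ¬ IsTriangulation latticePolytopeVertices (realize latticePoints latticeMaxDissection) := by
  rw [← range_latticePoints]
  -- the two diagonals of the parallelogram `s, e, n, w`
  exact not_isTriangulation_of_dependence latticePoints_injective (s := {0, 3, 4, 5})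
    (t := {1, 2, 6, 7}) (mem_realize.2 ⟨_, by decide, rfl⟩) (mem_realize.2 ⟨_, by decide, rfl⟩)
    (by decide) ![1, -1, -1, 1, 0, 0, 0, 0] (by decide) (by decide) (by decide) (by decide)
    (by decide)

theorem volume_of_mem_latticeMaxDissection {σ : Finset (Fin 3 → ℝ)}
    (hσ : σ ∈ realize latticePoints latticeMaxDissection) :
    volume (convexHull ℝ (σ : Set (Fin 3 → ℝ))) = ENNReal.ofReal (1 / 6) := by
  obtain ⟨s, hs, rfl⟩ := mem_realize.1 hσ
  have htet : ∀ s ∈ latticeMaxDissection, IsTetrahedron latticePoints s := by decide +kernel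
  have hunit : ∀ s ∈ latticeMaxDissection, ∀ a ∈ s, ∀ b ∈ s, ∀ c ∈ s, ∀ d ∈ s,
      (orient (latticePoints a) (latticePoints b) (latticePoints c) (latticePoints d) 1).natAbs
        ≤ 1 := by
    decide +kernel
  rw [(htet s hs).volume_eq (hunit s hs), volume_standardTetrahedron]

theorem lattice_integer_points :
    {x : Fin 3 → ℝ | x ∈ convexHull ℝ latticePolytopeVertices ∧ ∀ i, ∃ m : ℤ, x i = (m : ℝ)} =
      latticePolytopeVertices := by
  rw [← range_latticePoints]
  ext x
  constructor
  · rintro ⟨hx, hint⟩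
    choose m hm using hint
    obtain rfl : x = fun k => (m k : ℝ) := funext hm
    have hfacets : ∀ f ∈ latticeFacets, affineForm f m ≤ 0 := fun f hf =>
      affineForm_le_of_mem_convexHull
        ((by decide +kernel : ∀ f ∈ latticeFacets, ∀ i, affineForm f (latticePoints i) ≤ 0) f hf) hx
    simp only [latticeFacets, affineForm, List.forall_mem_cons, List.not_mem_nil] at hfacets
    simp at hfacets
    have key : ∃ i, latticePoints i 0 = m 0 ∧ latticePoints i 1 = m 1 ∧
        latticePoints i 2 = m 2 := by
      obtain ⟨h1, h2, h3, h4, h5, h6, h7, h8, h9, h10⟩ := hfacets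
      have hy : m 1 = 0 ∨ m 1 = 1 := by omega
      have hz : m 2 = -1 ∨ m 2 = 0 ∨ m 2 = 1 := by omega
      have hx : m 0 = -1 ∨ m 0 = 0 ∨ m 0 = 1 ∨ m 0 = 2 := by omega
      rcases hx with hx | hx | hx | hx <;> rcases hy with hy | hy <;>
        rcases hz with hz | hz | hz <;> rw [hx, hy, hz] <;>
        first
        | (exfalso; omega)
        | decide
    obtain ⟨i, h0, h1, h2⟩ := key
    refine ⟨i, ?_⟩
    ext k
    fin_cases k <;> simp [realPoint, h0, h1, h2]
  · rintro ⟨i, rfl⟩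
    exact ⟨subset_convexHull ℝ _ ⟨i, rfl⟩, fun k => ⟨latticePoints i k, rfl⟩⟩

/-! ### Certificates for the second polytope -/

/-- The points `u₁, w, v₁, s, v₂, n, u₂, e` of the second polytope. -/
def secondPoints : Fin 8 → Fin 3 → ℤ :=
  ![![1, 0, 0], ![1, 0, 1], ![-1, 0, 0], ![-1, 0, -1], ![0, 1, 1], ![1, 1, 1], ![0, 1, -1],
   ![-1, 1, -1]]

/-- Planes that separate the simplices of the dissections of the second polytope below. -/
def secondPlanes : List (Fin 4 → ℤ) :=
  [![1, 0, -1, 0], ![0, 1, -1, 0], ![1, 2, -2, -1], ![0, 1, 1, 0], ![1, -1, 0, 1], ![1, -2, 0, 1],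
   ![1, 2, 0, -1], ![0, 2, -1, -1], ![1, -1, -1, 1], ![1, 1, 0, -1], ![1, 0, -2, 1],
   ![1, 0, -2, -1], ![2, -3, -1, 2], ![0, 2, 1, -1], ![1, 1, -1, -1], ![2, 0, -1, 1],
   ![2, 0, -1, -1], ![1, -2, -2, 1], ![2, -2, -1, 1], ![2, 2, -1, -1], ![1, 3, -2, -1]]

/-- The unique minimal dissection of the second polytope. -/
def secondMinDissection : List (Finset (Fin 8)) :=
  [{0, 1, 3, 5}, {0, 3, 5, 6}, {1, 2, 3, 7}, {1, 2, 4, 7}, {1, 4, 5, 7}, {3, 5, 6, 7}]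

/-- Certificate that `secondMinDissection` covers the polytope. -/
def secondMinDissectionCover : List (Finset (Fin 8) × (Fin 8 → ℤ)) :=
  [({0, 1, 2, 3, 4, 5, 6, 7}, ![1, -1, 1, -1, 0, 0, 0, 0]),
   ({0, 1, 3, 4, 5, 6, 7}, ![2, -2, 0, 0, 1, 0, -1, 0]),
   ({0, 1, 3, 5, 6, 7}, ![0, 1, 0, -1, 0, -1, 0, 1]),
   ({0, 3, 5, 6, 7}, ![2, 0, 0, -2, 0, -1, -2, 3]),
   ({1, 2, 3, 4, 5, 6, 7}, ![0, 0, 2, -2, -1, 0, 1, 0]),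
   ({1, 2, 3, 4, 5, 7}, ![0, -1, 0, 1, 0, 1, 0, -1]),
   ({1, 2, 4, 5, 7}, ![0, -2, 2, 0, -2, 3, 0, -1]),
   ({1, 3, 4, 5, 6, 7}, ![0, 0, 0, 0, 1, -1, 1, -1]),
   ({1, 3, 4, 5, 7}, ![0, -1, 0, 1, 0, 1, 0, -1]),
   ({1, 2, 3, 4, 7}, ![0, -1, -2, 3, 2, 0, 0, -2]),
   ({1, 3, 5, 6, 7}, ![0, 1, 0, -1, 0, -1, 0, 1]),
   ({0, 1, 3, 5, 6}, ![-2, 3, 0, -1, 0, -2, 2, 0])]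

/-- Sample points and weights of the dual certificate for `secondMinDissection`. -/
def secondMinSamples : List ((Fin 3 → ℤ) × ℤ × ℤ) :=
  [(![-3, 5, -1], 6, -33), (![4, 4, 2], 7, -19), (![2, 4, 0], 7, 35), (![0, 6, -2], 7, -36),
   (![1, 5, -2], 7, 17), (![-1, 5, 2], 7, 68), (![0, 6, 2], 7, -35), (![2, 2, -1], 7, 1),
   (![0, 2, 1], 7, -18), (![-4, 4, -5], 7, 16), (![0, 3, -2], 7, -19), (![-2, 4, 0], 7, -31),
   (![-1, 5, 0], 7, 15), (![2, 1, 0], 7, -1), (![-5, 3, -4], 7, -35), (![-4, 4, -3], 7, 33),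
   (![7, 4, 5], 8, -19), (![1, 4, -1], 8, -16), (![-1, 3, -5], 8, -19), (![-1, 4, 1], 8, 1),
   (![-5, 5, -1], 8, -19), (![0, 5, 6], 8, -6)]

/-- The unique maximal dissection of the second polytope. -/
def secondMaxDissection : List (Finset (Fin 8)) :=
  [{0, 1, 3, 7}, {0, 1, 5, 6}, {0, 1, 6, 7}, {0, 3, 6, 7}, {1, 2, 3, 5}, {1, 2, 4, 5},
   {1, 5, 6, 7}, {2, 3, 4, 5}, {2, 3, 4, 7}, {3, 4, 5, 7}]

/-- Certificate that `secondMaxDissection` covers the polytope. -/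
def secondMaxDissectionCover : List (Finset (Fin 8) × (Fin 8 → ℤ)) :=
  [({0, 1, 2, 3, 4, 5, 6, 7}, ![1, -1, 1, -1, 0, 0, 0, 0]),
   ({0, 1, 3, 4, 5, 6, 7}, ![2, -2, 0, 0, 1, 0, -1, 0]),
   ({0, 1, 3, 5, 6, 7}, ![0, -1, 0, 1, 0, 1, 0, -1]),
   ({0, 1, 5, 6, 7}, ![2, -2, 0, 0, 0, 1, -2, 1]),
   ({1, 2, 3, 4, 5, 6, 7}, ![0, 0, 2, -2, -1, 0, 1, 0]),
   ({1, 2, 3, 4, 5, 7}, ![0, 1, 0, -1, 0, -1, 0, 1]),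
   ({2, 3, 4, 5, 7}, ![0, 0, 2, -2, -2, 1, 0, 1]),
   ({1, 3, 4, 5, 6, 7}, ![0, 0, 0, 0, 1, -1, 1, -1]),
   ({1, 3, 4, 5, 7}, ![0, 1, 0, -1, 0, -1, 0, 1]),
   ({1, 2, 3, 4, 5}, ![0, 1, -2, 1, 2, -2, 0, 0]),
   ({1, 3, 5, 6, 7}, ![0, -1, 0, 1, 0, 1, 0, -1]),
   ({0, 1, 3, 6, 7}, ![-2, 1, 0, 1, 0, 0, 2, -2])]

/-- Sample points and weights of the dual certificate for `secondMaxDissection`. -/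
def secondMaxSamples : List ((Fin 3 → ℤ) × ℤ × ℤ) :=
  [(![4, 6, 3], 11, 2), (![-3, 3, -4], 7, -38), (![-6, 8, -7], 13, 37), (![-11, 11, -19], 24, 20),
   (![-4, 13, -8], 19, -37), (![-3, 12, 3], 14, -6), (![-3, 1, 0], 7, 20), (![-2, 6, 2], 11, 21),
   (![-8, 18, -9], 25, -30), (![-4, 4, 2], 9, -17), (![10, 8, 3], 16, 20), (![-2, 7, 0], 8, 14),
   (![-10, 5, -4], 18, -35), (![13, 6, 8], 22, 32), (![1, 7, 5], 10, -2), (![-3, 12, -4], 18, 44),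
   (![-12, 4, -6], 17, 53), (![5, 3, 0], 9, 21), (![7, 3, 6], 9, 4), (![1, 6, -3], 12, -17),
   (![-1, 7, -6], 9, 21), (![2, 9, 7], 10, 12), (![-5, 5, -1], 8, 20), (![-4, 4, -5], 7, 21),
   (![6, 4, 8], 9, 20)]

/-- Three minimal triangulations of the second polytope. -/
def secondMinTriangulation : Fin 3 → List (Finset (Fin 8)) :=
  ![[{0, 1, 2, 5}, {0, 2, 3, 5}, {0, 3, 5, 6}, {1, 2, 4, 5}, {2, 3, 5, 7}, {2, 4, 5, 7},
     {3, 5, 6, 7}],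
    [{0, 1, 2, 5}, {0, 2, 3, 6}, {0, 2, 5, 6}, {1, 2, 4, 5}, {2, 3, 6, 7}, {2, 4, 5, 7},
     {2, 5, 6, 7}],
    [{0, 1, 2, 5}, {0, 2, 3, 6}, {0, 2, 5, 6}, {1, 2, 4, 5}, {2, 3, 6, 7}, {2, 4, 5, 6},
     {2, 4, 6, 7}]]

/-- Certificates that the triangulations `secondMinTriangulation` cover the polytope. -/
def secondMinTriangulationCover : Fin 3 → List (Finset (Fin 8) × (Fin 8 → ℤ)) :=
  ![[({0, 1, 2, 3, 4, 5, 6, 7}, ![-2, 2, 0, 0, -1, 0, 1, 0]),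
     ({0, 1, 2, 3, 4, 5, 7}, ![0, 1, 0, -1, 0, -1, 0, 1]),
     ({0, 1, 2, 3, 4, 5}, ![-1, 1, -1, 1, 0, 0, 0, 0]),
     ({0, 1, 2, 4, 5}, ![1, 0, -1, 0, 2, -2, 0, 0]),
     ({0, 2, 3, 4, 5}, ![1, 0, -1, 0, 2, -2, 0, 0]),
     ({0, 2, 3, 4, 5, 7}, ![1, 0, -1, 0, 2, -2, 0, 0]),
     ({0, 2, 3, 5, 7}, ![1, 0, 1, -2, 0, -1, 0, 1]),
     ({0, 3, 5, 6, 7}, ![2, 0, 0, -2, 0, -1, -2, 3]),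
     ({0, 2, 3, 4, 5, 6, 7}, ![1, 0, -1, 0, 2, -2, 0, 0]),
     ({0, 2, 3, 5, 6, 7}, ![1, 0, -1, 0, 0, 0, -2, 2]),
     ({0, 2, 3, 5, 6}, ![1, 0, 3, -4, 0, -2, 2, 0]),
     ({2, 3, 4, 5, 6, 7}, ![0, 0, 0, 0, 1, -1, 1, -1]),
     ({2, 3, 4, 5, 7}, ![0, 0, -2, 2, 2, -1, 0, -1]),
     ({2, 3, 5, 6, 7}, ![0, 0, 2, -2, 0, -1, 2, -1])],
    [({0, 1, 2, 3, 4, 5, 6, 7}, ![-1, 1, -1, 1, 0, 0, 0, 0]),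
     ({0, 1, 2, 4, 5, 6, 7}, ![-2, 2, 0, 0, -1, 0, 1, 0]),
     ({0, 1, 2, 4, 5, 7}, ![-3, 4, -1, 0, -2, 0, 0, 2]),
     ({0, 1, 2, 4, 5}, ![1, 0, -1, 0, 2, -2, 0, 0]),
     ({0, 2, 4, 5, 7}, ![1, 0, -1, 0, 2, -2, 0, 0]),
     ({0, 2, 3, 4, 5, 6, 7}, ![0, 0, -2, 2, 1, 0, -1, 0]),
     ({0, 2, 3, 5, 6, 7}, ![-1, 0, -3, 4, 0, 2, -2, 0]),
     ({0, 2, 3, 6, 7}, ![1, 0, -1, 0, 0, 0, -2, 2]),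
     ({0, 2, 4, 5, 6, 7}, ![1, 0, -1, 0, 2, -2, 0, 0]),
     ({0, 2, 5, 6, 7}, ![1, 0, -1, 0, 0, 0, -2, 2]),
     ({2, 4, 5, 6, 7}, ![0, 0, 0, 0, 1, -1, 1, -1])],
    [({0, 1, 2, 3, 4, 5, 6, 7}, ![-1, 1, -1, 1, 0, 0, 0, 0]),
     ({0, 1, 2, 4, 5, 6, 7}, ![-3, 4, -1, 0, -2, 0, 0, 2]),
     ({0, 1, 2, 4, 5, 6}, ![-2, 2, 0, 0, -1, 0, 1, 0]),
     ({0, 1, 2, 4, 5}, ![1, 0, -1, 0, 2, -2, 0, 0]),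
     ({0, 2, 4, 5, 6, 7}, ![1, 0, -1, 0, 0, 0, -2, 2]),
     ({2, 4, 5, 6, 7}, ![0, 0, 0, 0, -1, 1, -1, 1]),
     ({0, 2, 3, 4, 5, 6, 7}, ![1, 0, -1, 0, 0, 0, -2, 2]),
     ({0, 2, 3, 4, 5, 6}, ![0, 0, -2, 2, 1, 0, -1, 0]),
     ({0, 2, 4, 5, 6}, ![1, 0, -1, 0, 2, -2, 0, 0]),
     ({2, 3, 4, 5, 6, 7}, ![0, 0, 0, 0, -1, 1, -1, 1]),
     ({2, 3, 4, 5, 6}, ![0, 0, -2, 2, 1, 0, -1, 0]),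
     ({0, 2, 3, 5, 6}, ![-1, 0, -3, 4, 0, 2, -2, 0]),
     ({2, 3, 4, 6, 7}, ![0, 0, -2, 2, 1, 0, -1, 0])]]

/-- Three maximal triangulations of the second polytope. -/
def secondMaxTriangulation : Fin 3 → List (Finset (Fin 8)) :=
  ![[{0, 1, 2, 5}, {0, 2, 3, 5}, {0, 3, 5, 7}, {0, 3, 6, 7}, {0, 5, 6, 7}, {1, 2, 4, 5},
     {2, 3, 4, 5}, {2, 3, 4, 7}, {3, 4, 5, 7}],
    [{0, 1, 3, 5}, {0, 3, 5, 7}, {0, 3, 6, 7}, {0, 5, 6, 7}, {1, 2, 3, 5}, {1, 2, 4, 5},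
     {2, 3, 4, 5}, {2, 3, 4, 7}, {3, 4, 5, 7}],
    [{0, 1, 2, 4}, {0, 1, 4, 5}, {0, 2, 3, 4}, {0, 3, 4, 5}, {0, 3, 5, 7}, {0, 3, 6, 7},
     {0, 5, 6, 7}, {2, 3, 4, 7}, {3, 4, 5, 7}]]

/-- Certificates that the triangulations `secondMaxTriangulation` cover the polytope. -/
def secondMaxTriangulationCover : Fin 3 → List (Finset (Fin 8) × (Fin 8 → ℤ)) :=
  ![[({0, 1, 2, 3, 4, 5, 6, 7}, ![-2, 2, 0, 0, -1, 0, 1, 0]),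
     ({0, 1, 2, 3, 4, 5, 7}, ![0, 1, 0, -1, 0, -1, 0, 1]),
     ({0, 1, 2, 3, 4, 5}, ![-1, 1, -1, 1, 0, 0, 0, 0]),
     ({0, 1, 2, 4, 5}, ![1, 0, -1, 0, 2, -2, 0, 0]),
     ({0, 2, 3, 4, 5}, ![1, 0, -1, 0, 2, -2, 0, 0]),
     ({0, 2, 3, 4, 5, 7}, ![1, 0, -1, 0, 2, -2, 0, 0]),
     ({0, 2, 3, 4, 5, 6, 7}, ![1, 0, -1, 0, 2, -2, 0, 0]),
     ({0, 2, 3, 5, 6, 7}, ![-1, 0, 1, 0, 0, 0, 2, -2]),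
     ({0, 2, 3, 5, 7}, ![1, 0, 1, -2, 0, -1, 0, 1]),
     ({2, 3, 4, 5, 6, 7}, ![0, 0, 2, -2, -1, 0, 1, 0]),
     ({2, 3, 4, 5, 7}, ![0, 0, 2, -2, -2, 1, 0, 1]),
     ({3, 4, 5, 6, 7}, ![0, 0, 0, 0, 1, -1, 1, -1]),
     ({0, 3, 5, 6, 7}, ![-2, 0, 0, 2, 0, 1, 2, -3])],
    [({0, 1, 2, 3, 4, 5, 6, 7}, ![-1, 0, 1, 0, 0, 0, 2, -2]),
     ({0, 1, 2, 3, 4, 5, 7}, ![1, -1, 1, -1, 0, 0, 0, 0]),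
     ({1, 2, 3, 4, 5, 7}, ![0, 1, 0, -1, 0, -1, 0, 1]),
     ({2, 3, 4, 5, 7}, ![0, 0, 2, -2, -2, 1, 0, 1]),
     ({0, 1, 3, 4, 5, 6, 7}, ![0, 0, 0, 0, 1, -1, 1, -1]),
     ({0, 1, 3, 4, 5, 7}, ![2, -1, 0, -1, 2, -2, 0, 0]),
     ({1, 3, 4, 5, 7}, ![0, 1, 0, -1, 0, -1, 0, 1]),
     ({1, 2, 3, 4, 5}, ![0, 1, -2, 1, 2, -2, 0, 0]),
     ({0, 1, 3, 5, 6, 7}, ![-2, 3, 0, -1, 0, -2, 2, 0]),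
     ({0, 1, 3, 5, 7}, ![0, 1, 0, -1, 0, -1, 0, 1]),
     ({0, 3, 5, 6, 7}, ![-2, 0, 0, 2, 0, 1, 2, -3])],
    [({0, 1, 2, 3, 4, 5, 6, 7}, ![-2, 2, 0, 0, -1, 0, 1, 0]),
     ({0, 1, 2, 3, 4, 5, 7}, ![0, 1, 0, -1, 0, -1, 0, 1]),
     ({0, 1, 2, 3, 4, 5}, ![-1, 1, -1, 1, 0, 0, 0, 0]),
     ({0, 1, 2, 4, 5}, ![-1, 0, 1, 0, -2, 2, 0, 0]),
     ({0, 2, 3, 4, 5}, ![-1, 0, 1, 0, -2, 2, 0, 0]),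
     ({0, 2, 3, 4, 5, 6, 7}, ![-1, 0, 1, 0, 0, 0, 2, -2]),
     ({0, 2, 3, 4, 5, 7}, ![-1, 0, 1, 0, -2, 2, 0, 0]),
     ({0, 2, 3, 4, 7}, ![1, 0, 3, -4, -2, 0, 0, 2]),
     ({0, 3, 4, 5, 6, 7}, ![0, 0, 0, 0, 1, -1, 1, -1]),
     ({0, 3, 4, 5, 7}, ![2, 0, 0, -2, 2, -3, 0, 1]),
     ({0, 3, 5, 6, 7}, ![-2, 0, 0, 2, 0, 1, 2, -3])]]

/-- For each vertex of the second polytope, an affine form that vanishes there and is negative at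
the other vertices. -/
def secondSupports : Fin 8 → Fin 4 → ℤ :=
  ![![1, -1, -1, -1], ![0, -1, 1, -1], ![-1, -1, 1, -1], ![0, -1, -1, -1], ![-1, 0, 2, -2],
    ![1, 1, 0, -2], ![1, 0, -2, -2], ![-1, 1, 0, -2]]

/-! ### The second polytope -/

theorem secondPoints_injective : Function.Injective secondPoints := by decide

theorem range_secondPoints : Set.range (realPoint secondPoints) = secondPolytopeVertices := by
  have h : realPoint secondPoints = ![![1, 0, 0], ![1, 0, 1], ![-1, 0, 0], ![-1, 0, -1], ![0, 1, 1],
      ![1, 1, 1], ![0, 1, -1], ![-1, 1, -1]] := by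
    ext i k
    fin_cases i <;> fin_cases k <;> simp [realPoint, secondPoints]
  rw [h, secondPolytopeVertices]
  ext x
  simp only [Matrix.range_cons, Matrix.range_empty, Set.union_empty, Set.mem_union,
    Set.mem_singleton_iff, Set.mem_insert_iff]

theorem second_isPolytopeVertexSet : IsPolytopeVertexSet secondPolytopeVertices 8 := by
  rw [← range_secondPoints]
  -- supporting planes at the eight vertices
  have hext : ∀ i, affineForm (secondSupports i) (secondPoints i) = 0 ∧
      ∀ j, j ≠ i → affineForm (secondSupports i) (secondPoints j) < 0 := by
    decide +kernel
  exact isPolytopeVertexSet_range secondPoints_injective (fun i => ⟨_, hext i⟩) (by decide +kernel)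

theorem secondMinDissection_isDissection :
    IsDissection secondPolytopeVertices (realize secondPoints secondMinDissection) := by
  rw [← range_secondPoints]
  exact isDissection_realize (F := secondPlanes) (L := secondMinDissectionCover)
    (by decide +kernel) (by decide +kernel) (by decide +kernel)

theorem secondMaxDissection_isDissection :
    IsDissection secondPolytopeVertices (realize secondPoints secondMaxDissection) := by
  rw [← range_secondPoints]
  exact isDissection_realize (F := secondPlanes) (L := secondMaxDissectionCover)
    (by decide +kernel) (by decide +kernel) (by decide +kernel)

theorem second_dissection_card_ge {D : Finset (Finset (Fin 3 → ℝ))}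
    (hD : IsDissection secondPolytopeVertices D) :
    6 ≤ D.card ∧ (D.card = 6 → D = realize secondPoints secondMinDissection) := by
  rw [← range_secondPoints] at hD
  -- a negative bound on the weights turns the upper bound into a lower bound
  have hcert : IsDualCertificate secondPoints secondMinDissection secondMinSamples (-20) := by
    decide +kernel
  obtain ⟨hle, heq⟩ := hcert.card_le_and_eq secondPoints_injective (by decide) hD
  have hlen : secondMinDissection.length = 6 := rfl
  rw [hlen] at hle heq
  exact ⟨by omega, heq⟩

theorem card_secondMinDissection : (realize secondPoints secondMinDissection).card = 6 :=
  card_realize secondPoints_injective (by decide)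

theorem second_dissection_card_le {D : Finset (Finset (Fin 3 → ℝ))}
    (hD : IsDissection secondPolytopeVertices D) :
    D.card ≤ 10 ∧ (D.card = 10 → D = realize secondPoints secondMaxDissection) := by
  rw [← range_secondPoints] at hD
  have hcert : IsDualCertificate secondPoints secondMaxDissection secondMaxSamples (20) := by
    decide +kernel
  obtain ⟨hle, heq⟩ := hcert.card_le_and_eq secondPoints_injective (by decide) hD
  have hlen : secondMaxDissection.length = 10 := rfl
  rw [hlen] at hle heq
  exact ⟨by omega, heq⟩

theorem card_secondMaxDissection : (realize secondPoints secondMaxDissection).card = 10 :=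
  card_realize secondPoints_injective (by decide)

theorem secondMinTriangulation_isTriangulation (j : Fin 3) :
    IsTriangulation secondPolytopeVertices (realize secondPoints (secondMinTriangulation j)) := by
  rw [← range_secondPoints]
  have htet : ∀ j, ∀ s ∈ secondMinTriangulation j, IsTetrahedron secondPoints s := by
    decide +kernel
  have hsep : ∀ j, (secondMinTriangulation j).Pairwise
      (AreSeparated secondPoints secondPlanes) := by
    decide +kernel
  have hcov : ∀ j, coveredBy secondPoints (secondMinTriangulation j)
      (secondMinTriangulationCover j) Finset.univ = true := by decide +kernel
  -- each cut lowers the dimension of the span of the two vertex sets, so three cuts suffice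
  have hface : ∀ j, (secondMinTriangulation j).Pairwise fun s t =>
      meetInFace secondPoints secondPlanes 3 s t = true := by decide +kernel
  exact isTriangulation_realize (isDissection_realize (htet j) (hsep j) (hcov j)) (hface j)

theorem card_secondMinTriangulation (j : Fin 3) :
    (realize secondPoints (secondMinTriangulation j)).card = 7 := by
  have hnodup : ∀ j, (secondMinTriangulation j).Nodup := by decide +kernel
  rw [card_realize secondPoints_injective (hnodup j)]
  fin_cases j <;> rfl

theorem secondMaxTriangulation_isTriangulation (j : Fin 3) :
    IsTriangulation secondPolytopeVertices (realize secondPoints (secondMaxTriangulation j)) := by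
  rw [← range_secondPoints]
  have htet : ∀ j, ∀ s ∈ secondMaxTriangulation j, IsTetrahedron secondPoints s := by
    decide +kernel
  have hsep : ∀ j, (secondMaxTriangulation j).Pairwise
      (AreSeparated secondPoints secondPlanes) := by
    decide +kernel
  have hcov : ∀ j, coveredBy secondPoints (secondMaxTriangulation j)
      (secondMaxTriangulationCover j) Finset.univ = true := by decide +kernel
  -- each cut lowers the dimension of the span of the two vertex sets, so three cuts suffice
  have hface : ∀ j, (secondMaxTriangulation j).Pairwise fun s t =>
      meetInFace secondPoints secondPlanes 3 s t = true := by decide +kernel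
  exact isTriangulation_realize (isDissection_realize (htet j) (hsep j) (hcov j)) (hface j)

theorem card_secondMaxTriangulation (j : Fin 3) :
    (realize secondPoints (secondMaxTriangulation j)).card = 9 := by
  have hnodup : ∀ j, (secondMaxTriangulation j).Nodup := by decide +kernel
  rw [card_realize secondPoints_injective (hnodup j)]
  fin_cases j <;> rfl

theorem secondMinDissection_not_isTriangulation :
    ¬ IsTriangulation secondPolytopeVertices (realize secondPoints secondMinDissection) := by
  rw [← range_secondPoints]
  -- the two diagonals of the parallelogram `w, s, e, n`
  exact not_isTriangulation_of_dependence secondPoints_injective (s := {0, 3, 5, 6})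
    (t := {1, 2, 4, 7}) (mem_realize.2 ⟨_, by decide, rfl⟩) (mem_realize.2 ⟨_, by decide, rfl⟩)
    (by decide) ![0, -1, 0, 1, 0, 1, 0, -1] (by decide) (by decide) (by decide) (by decide)
    (by decide)

theorem secondMaxDissection_not_isTriangulation :
    ¬ IsTriangulation secondPolytopeVertices (realize secondPoints secondMaxDissection) := by
  rw [← range_secondPoints]
  exact not_isTriangulation_of_dependence secondPoints_injective (s := {0, 1, 6, 7})
    (t := {2, 3, 4, 5}) (mem_realize.2 ⟨_, by decide, rfl⟩) (mem_realize.2 ⟨_, by decide, rfl⟩)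
    (by decide) ![0, 1, 0, -1, 0, -1, 0, 1] (by decide) (by decide) (by decide) (by decide)
    (by decide)

/-! ### Extremal dissections and triangulations of the two polytopes -/

theorem mainTheorem3 :
    -- the lattice polytope
    (IsPolytopeVertexSet latticePolytopeVertices 8 ∧
      {x : Fin 3 → ℝ | x ∈ convexHull ℝ latticePolytopeVertices ∧ ∀ i, ∃ m : ℤ, x i = (m : ℝ)} =
        latticePolytopeVertices ∧
      -- its unique maximal dissection
      (∃ D : Finset (Finset (Fin 3 → ℝ)),
        IsMaxDissection latticePolytopeVertices D ∧
        (∀ D', IsMaxDissection latticePolytopeVertices D' → D' = D) ∧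
        D.card = 12 ∧
        ∀ σ ∈ D, volume (convexHull ℝ (σ : Set (Fin 3 → ℝ))) = ENNReal.ofReal (1 / 6)) ∧
      -- its several maximal triangulations
      2 < {T | IsMaxTriangulation latticePolytopeVertices T}.encard ∧
      (∀ T, IsMaxTriangulation latticePolytopeVertices T → T.card = 11)) ∧
    -- the second polytope
    (IsPolytopeVertexSet secondPolytopeVertices 8 ∧
      -- its unique minimal dissection
      (∃ D : Finset (Finset (Fin 3 → ℝ)),
        IsMinDissection secondPolytopeVertices D ∧
        (∀ D', IsMinDissection secondPolytopeVertices D' → D' = D) ∧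
        D.card = 6) ∧
      -- its several minimal triangulations
      2 < {T | IsMinTriangulation secondPolytopeVertices T}.encard ∧
      (∀ T, IsMinTriangulation secondPolytopeVertices T → T.card = 7) ∧
      -- its several maximal triangulations
      2 < {T | IsMaxTriangulation secondPolytopeVertices T}.encard ∧
      (∀ T, IsMaxTriangulation secondPolytopeVertices T → T.card = 9) ∧
      -- its unique maximal dissection
      (∃ D : Finset (Finset (Fin 3 → ℝ)),
        IsMaxDissection secondPolytopeVertices D ∧
        (∀ D', IsMaxDissection secondPolytopeVertices D' → D' = D) ∧
        D.card = 10)) := by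
  have lat := several_isMaxTriangulation (m := 11)
    (fun D hD => (lattice_dissection_card_le hD).1) (fun D hD => (lattice_dissection_card_le hD).2)
    latticeMaxDissection_not_isTriangulation latticeMaxTriangulation_isTriangulation
    card_latticeMaxTriangulation (injective_realize latticePoints_injective (by decide +kernel))
  have secMin := several_isMinTriangulation (m := 6)
    (fun D hD => (second_dissection_card_ge hD).1) (fun D hD => (second_dissection_card_ge hD).2)
    secondMinDissection_not_isTriangulation secondMinTriangulation_isTriangulation
    card_secondMinTriangulation (injective_realize secondPoints_injective (by decide +kernel))
  have secMax := several_isMaxTriangulation (m := 9)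
    (fun D hD => (second_dissection_card_le hD).1) (fun D hD => (second_dissection_card_le hD).2)
    secondMaxDissection_not_isTriangulation secondMaxTriangulation_isTriangulation
    card_secondMaxTriangulation (injective_realize secondPoints_injective (by decide +kernel))
  refine ⟨⟨lattice_isPolytopeVertexSet, lattice_integer_points, ?_, lat.1, lat.2⟩,
    second_isPolytopeVertexSet, ?_, secMin.1, secMin.2, secMax.1, secMax.2, ?_⟩
  · obtain ⟨hmax, huniq⟩ := isMaxDissection_and_unique latticeMaxDissection_isDissection
      card_latticeMaxDissection (fun D hD => (lattice_dissection_card_le hD).1)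
      (fun D hD => (lattice_dissection_card_le hD).2)
    exact ⟨_, hmax, huniq, card_latticeMaxDissection, fun σ => volume_of_mem_latticeMaxDissection⟩
  · obtain ⟨hmin, huniq⟩ := isMinDissection_and_unique secondMinDissection_isDissection
      card_secondMinDissection (fun D hD => (second_dissection_card_ge hD).1)
      (fun D hD => (second_dissection_card_ge hD).2)
    exact ⟨_, hmin, huniq, card_secondMinDissection⟩
  · obtain ⟨hmax, huniq⟩ := isMaxDissection_and_unique secondMaxDissection_isDissection
      card_secondMaxDissection (fun D hD => (second_dissection_card_le hD).1)
      (fun D hD => (second_dissection_card_le hD).2)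
    exact ⟨_, hmax, huniq, card_secondMaxDissection⟩
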